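/- Let $\mathcal{G}=(V,\mathcal{E})$ be a finite hypergraph (parallel hyperedges allowed, every hyperedge consisting of at least two vertices), let $h,k$ be positive integers, $K=\{1,\dots,k\}$ and $\ell:K\to\mathbb{Z}_{>0}$. There exists an $h$-regular packing of $k$ rooted hyperforests in $\mathcal{G}$ with $\ell(1),\dots,\ell(k)$ roots if and only if the following three conditions hold: $$|V|\ge \ell(i)\quad\text{for every } 1\le i\le k,$$ $$h|V|\ge \sum_{i=1}^k\ell(i),$$ $$\sum_{i=1}^k\min\{\ell(i),|\mathcal{P}|\}+e_{\mathcal{E}}(\mathcal{P})\ \ge\ h|\mathcal{P}|\quad\text{for every partition }\mathcal{P}\text{ of }V.$$ Here $e_{\mathcal{E}}(\mathcal{P})$ is the number of hyperedges in $\mathcal{E}$ that intersect some member of $\mathcal{P}$ without being contained in it. A digraph $(U,F)$ is an $S$-branching if $S\subseteq U$ and every $u\in U$ is reached by exactly one directed path starting in $S$ (paths may repeat vertices, so that $S$-branchings are exactly the vertex-disjoint unions of arborescences with one root at each $s\in S$). A directed hypergraph $\mathcal{B}=(U,\mathcal{F})$, in which every hyperarc has one head and at least one tail, is an $S$-hyperbranching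 if $S\subseteq U$ and each hyperarc can be replaced by an arc from one of its tails to its head such that the resulting arcs form an $S$-branching on the core of $\mathcal{B}$, which is the union of $S$ and the set of vertices of in-degree at least $1$ in $\mathcal{B}$. A hypergraph is an $S$-hyperforest (a rooted hyperforest with $|S|$ roots) if one can choose a head in each hyperedge, the other vertices becoming tails, such that an $S$-hyperbranching is obtained. A packing of $k$ rooted hyperforests in $\mathcal{G}$ is a family of $k$ pairwise hyperedge-disjoint subhypergraphs $\mathcal{T}_1,\dots,\mathcal{T}_k$ of $\mathcal{G}$, where $\mathcal{T}_i$ is an $S_i$-hyperforest; it is $h$-regular if each $\mathcal{T}_i$ can be oriented to an $S_i$-hyperbranching such that every vertex of $\mathcal{G}$ belongs to exactly $h$ of the $k$ cores. -/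

import Mathlib

/-- A finite directed multigraph: vertices are taken from `V`, arcs are labelled by `E`
(so parallel arcs are allowed). -/
structure MultiDigraph (V E : Type*) where
  verts : Finset V
  arcs : Finset E
  tail : E → V
  head : E → V
  tail_mem : ∀ a ∈ arcs, tail a ∈ verts
  head_mem : ∀ a ∈ arcs, head a ∈ verts

/-- A finite directed hypergraph (dypergraph), parallel hyperarcs allowed: a hyperarc has exactly
one head and at least one tail, and its head is not one of its tails. -/
structure Dypergraph (V E : Type*) where
  verts : Finset V
  hyperarcs : Finset E
  tails : E → Finset V
  head : E → V
  tails_subset : ∀ a ∈ hyperarcs, tails a ⊆ verts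
  head_mem : ∀ a ∈ hyperarcs, head a ∈ verts
  tails_nonempty : ∀ a ∈ hyperarcs, (tails a).Nonempty
  head_notMem_tails : ∀ a ∈ hyperarcs, head a ∉ tails a

/-- A finite hypergraph, parallel hyperedges allowed: the hyperedge labelled `e` is the vertex set
`ends e`, and it consists of at least two vertices. -/
structure MultiHypergraph (V E : Type*) where
  verts : Finset V
  edges : Finset E
  ends : E → Finset V
  ends_subset : ∀ e ∈ edges, ends e ⊆ verts
  two_le_card_ends : ∀ e ∈ edges, 2 ≤ (ends e).card

namespace MultiDigraph

variable {V E : Type*}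

/-- `D.IsDipath x l y`: the list of arcs `l` is a directed path of `D` from `x` to `y`
(consecutive arcs; the empty list is the trivial path from `x` to `x`). -/
def IsDipath (D : MultiDigraph V E) : V → List E → V → Prop
  | x, [], y => x = y
  | x, a :: l, y => a ∈ D.arcs ∧ D.tail a = x ∧ D.IsDipath (D.head a) l y

/-- `D` is a branching with root set `S`: `S` is a set of vertices of `D`, and every vertex `u` is
reached by exactly one directed path starting in `S`. As repeated vertices are not excluded from
paths a priori, uniqueness forces in-degree `0` on `S`, in-degree `1` elsewhere, and no directed
cycles. -/
def IsBranching (D : MultiDigraph V E) (S : Finset V) : Prop :=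
  S ⊆ D.verts ∧ ∀ u ∈ D.verts, ∃! p : V × List E, p.1 ∈ S ∧ D.IsDipath p.1 p.2 u

end MultiDigraph

namespace Dypergraph

variable {V E : Type*} [DecidableEq V]

/-- The number of hyperarcs entering `X`: head in `X`, at least one tail outside `X`. -/
def inDegree (D : Dypergraph V E) (X : Finset V) : ℕ :=
  (D.hyperarcs.filter fun a => D.head a ∈ X ∧ ¬ D.tails a ⊆ X).card

/-- The set of vertices of in-degree at least one, together with `S`. -/
def core (D : Dypergraph V E) (S : Finset V) : Finset V :=
  (D.verts.filter fun v => 1 ≤ D.inDegree {v}) ∪ S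

/-- The arcs of `A` are obtained by trimming the hyperarcs of `D`: each hyperarc is replaced by an
arc from one of its tails to its head. -/
def IsTrimming (D : Dypergraph V E) (A : MultiDigraph V E) : Prop :=
  A.arcs = D.hyperarcs ∧ ∀ a ∈ D.hyperarcs, A.head a = D.head a ∧ A.tail a ∈ D.tails a

/-- `D` is a hyperbranching with root set `S`: its hyperarcs can be trimmed to arcs that form, on
the core of `D`, a branching with root set `S`. -/
def IsHyperbranching (D : Dypergraph V E) (S : Finset V) : Prop :=
  S ⊆ D.verts ∧
    ∃ A : MultiDigraph V E, A.verts = D.core S ∧ D.IsTrimming A ∧ A.IsBranching S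

end Dypergraph

namespace MultiHypergraph

variable {V E : Type*} [DecidableEq V]

/-- `D` is obtained from `H` by choosing in each hyperedge a vertex to be its head; the other
vertices of the hyperedge become the tails. -/
def IsOrientation (H : MultiHypergraph V E) (D : Dypergraph V E) : Prop :=
  D.verts = H.verts ∧ D.hyperarcs = H.edges ∧
    ∀ e ∈ H.edges, D.head e ∈ H.ends e ∧ D.tails e = (H.ends e).erase (D.head e)

/-- `H` is a hyperforest with root set `S`. -/
def IsHyperforest (H : MultiHypergraph V E) (S : Finset V) : Prop :=
  ∃ D : Dypergraph V E, H.IsOrientation D ∧ D.IsHyperbranching S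

/-- `H` is a subhypergraph of `G`. -/
def IsSubhypergraph (H G : MultiHypergraph V E) : Prop :=
  H.verts ⊆ G.verts ∧ H.edges ⊆ G.edges ∧ ∀ e ∈ H.edges, H.ends e = G.ends e

/-- The number of hyperedges of `G` that enter some member of the partition `P`, where a hyperedge
enters `X` if it contains a vertex in `X` and a vertex outside `X`. -/
def numEntering (G : MultiHypergraph V E) (P : Finpartition G.verts) : ℕ :=
  (G.edges.filter fun e => ∃ X ∈ P.parts, (G.ends e ∩ X).Nonempty ∧ (G.ends e \ X).Nonempty).card

/-- `H 0, …, H (k-1)` is a packing in `G` of hyperforests with root sets `S 0, …, S (k-1)`: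
they are pairwise hyperedge-disjoint subhypergraphs of `G`. -/
def IsPacking (G : MultiHypergraph V E) {k : ℕ} (H : Fin k → MultiHypergraph V E)
    (S : Fin k → Finset V) : Prop :=
  (∀ i, (H i).IsSubhypergraph G ∧ (H i).IsHyperforest (S i)) ∧
    Pairwise fun i j => Disjoint (H i).edges (H j).edges

/-- The packing is `h`-regular: the hyperforests can be oriented to hyperbranchings (with the same
root sets) such that every vertex of `G` belongs to exactly `h` of their cores. -/
def IsRegularPacking (G : MultiHypergraph V E) (h : ℕ) {k : ℕ} (H : Fin k → MultiHypergraph V E)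
    (S : Fin k → Finset V) : Prop :=
  G.IsPacking H S ∧
    ∃ D : Fin k → Dypergraph V E,
      (∀ i, (H i).IsOrientation (D i) ∧ (D i).IsHyperbranching (S i)) ∧
      ∀ v ∈ G.verts, (Finset.univ.filter fun i => v ∈ (D i).core (S i)).card = h

end MultiHypergraph

/-!
Necessity: a branching whose core meets a part `X` of a partition has a root in `X` or a hyperarc
entering `X`. Every vertex lies in `h` cores, so summing over the parts gives the partition
condition.

Sufficiency: replacing each minimum `min (ℓ i) |P|` by a choice between `ℓ i` and `|P|` turns the
partition condition into a family of linear inequalities. These are intersecting supermodular, so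
the partitions attaining equality are closed under `⊓`. Uncrossing them shows two things: a minimal
subfamily `F` of the hyperedges that still satisfies the inequalities has exactly `h|V| - ∑ i, ℓ i`
members, and the root sets can be chosen one at a time, because a minimal feasible root set for
branching `i` has at most `ℓ i` vertices. With the roots in place, the inequalities for partitions
into a set `X` and singletons become an upper bound on the number of hyperedges inside `X` and roots
in `X`. In a minimal critical set attaining that bound some hyperedge contains a root `u` of a
branching and a vertex `v` that can still join it; trimming the hyperedge to the arc `uv` and
making `v` a root of that branching preserves the bound, and induction on the number of hyperedges
finishes the proof.
-/

open Finset

namespace HyperforestPacking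

variable {V : Type*} [DecidableEq V]

/-- A demand function on vertex sets: antitone and supermodular. Starting from a constant, it
records how many further branchings a vertex set still has to receive. -/
structure IsDemand (p : Finset V → ℤ) : Prop where
  antitone : Antitone p
  supermodular : ∀ X Y, p X + p Y ≤ p (X ∩ Y) + p (X ∪ Y)

/-- The total excess of the demand `p` over the level `c` on the parts of `P`. -/
def totalExcess {U : Finset V} (p : Finset V → ℤ) (c : ℤ) (P : Finpartition U) : ℤ :=
  ∑ X ∈ P.parts, max (p X - c) 0

theorem isDemand_const (a : ℤ) : IsDemand fun _ : Finset V ↦ a :=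
  ⟨antitone_const, fun _ _ ↦ le_rfl⟩

theorem IsDemand.max_sub_union_le {p : Finset V → ℤ} (hp : IsDemand p) (c : ℤ) (X Y : Finset V) :
    max (p (X ∪ Y) - c) 0 ≤ max (p X - c) 0 + max (p Y - c) 0 := by
  have hX : p (X ∪ Y) ≤ p X := hp.antitone subset_union_left
  omega

theorem IsDemand.max_sub_add_le_of_disjoint {p : Finset V → ℤ} (hp : IsDemand p) {c c' : ℤ}
    (hc : c ≤ c') {x y X Y : Finset V} (hx : x ⊆ X) (hy : y ⊆ Y) (hXY : Disjoint X Y) :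
    max (p X - c') 0 + max (p Y - c') 0 + max (p (x ∪ y) - c) 0 ≤
      max (p x - c) 0 + max (p y - c) 0 + max (p (X ∪ Y) - c') 0 := by
  have hXx : p X + p (x ∪ y) ≤ p x + p (X ∪ y) := by
    have := hp.supermodular X (x ∪ y)
    rwa [inter_union_distrib_left, inter_eq_right.2 hx,
      disjoint_iff_inter_eq_empty.1 (hXY.mono_right hy), union_empty, ← union_assoc,
      union_eq_left.2 hx] at this
  have hYy : p (X ∪ y) + p Y ≤ p y + p (X ∪ Y) := by
    have := hp.supermodular (X ∪ y) Y
    rwa [union_inter_distrib_right, disjoint_iff_inter_eq_empty.1 hXY, empty_union,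
      inter_eq_left.2 hy, union_assoc, union_eq_right.2 hy] at this
  have hxX : p X ≤ p x := hp.antitone hx
  have hyY : p Y ≤ p y := hp.antitone hy
  have hx' : p (x ∪ y) ≤ p x := hp.antitone subset_union_left
  have hy' : p (x ∪ y) ≤ p y := hp.antitone subset_union_right
  have hX' : p (X ∪ Y) ≤ p X := hp.antitone subset_union_left
  have hY' : p (X ∪ Y) ≤ p Y := hp.antitone subset_union_right
  omega

section MergeParts

variable {U : Finset V}

/-- The partition obtained from `P` by replacing the parts `X` and `Y` by their union. -/
def mergeParts (P : Finpartition U) {X Y : Finset V} (hX : X ∈ P.parts) (hY : Y ∈ P.parts) :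
    Finpartition U :=
  (P.ofSubset (parts := (P.parts.erase X).erase Y)
      ((erase_subset _ _).trans (erase_subset _ _)) rfl).extend (b := X ∪ Y)
    (((P.nonempty_of_mem_parts hX).mono subset_union_left).ne_empty)
    (Finset.disjoint_sup_left.2 fun Z hZ ↦ by
      obtain ⟨hZY, hZX, hZ⟩ := by simpa only [mem_erase] using hZ
      exact disjoint_union_right.2 ⟨P.disjoint hZ hX hZX, P.disjoint hZ hY hZY⟩)
    (by
      apply subset_antisymm
      · exact union_subset
          (Finset.sup_le fun Z hZ ↦ P.subset (mem_of_mem_erase (mem_of_mem_erase hZ)))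
          (union_subset (P.subset hX) (P.subset hY))
      · intro v hv
        obtain ⟨Z, hZ, hvZ⟩ := P.exists_mem hv
        by_cases hZX : Z = X
        · exact mem_union_right _ (mem_union_left _ (hZX ▸ hvZ))
        by_cases hZY : Z = Y
        · exact mem_union_right _ (mem_union_right _ (hZY ▸ hvZ))
        exact mem_union_left _ (Finset.mem_sup.2
          ⟨Z, mem_erase.2 ⟨hZY, mem_erase.2 ⟨hZX, hZ⟩⟩, hvZ⟩))

variable {P R : Finpartition U} {X Y : Finset V} (hX : X ∈ P.parts) (hY : Y ∈ P.parts)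

theorem parts_mergeParts :
    (mergeParts P hX hY).parts = insert (X ∪ Y) ((P.parts.erase X).erase Y) :=
  rfl

theorem le_mergeParts : P ≤ mergeParts P hX hY := by
  intro Z hZ
  rw [parts_mergeParts]
  by_cases hZX : Z = X
  · exact ⟨X ∪ Y, mem_insert_self _ _, hZX ▸ subset_union_left⟩
  by_cases hZY : Z = Y
  · exact ⟨X ∪ Y, mem_insert_self _ _, hZY ▸ subset_union_right⟩
  exact ⟨Z, mem_insert_of_mem (mem_erase.2 ⟨hZY, mem_erase.2 ⟨hZX, hZ⟩⟩), le_rfl⟩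

theorem mergeParts_le (hPR : P ≤ R) {Z : Finset V} (hZ : Z ∈ R.parts) (hXYZ : X ∪ Y ⊆ Z) :
    mergeParts P hX hY ≤ R := by
  intro W hW
  rcases mem_insert.1 hW with rfl | hW
  · exact ⟨Z, hZ, hXYZ⟩
  · exact hPR (mem_of_mem_erase (mem_of_mem_erase hW))

theorem sum_mergeParts {M : Type*} [AddCommMonoid M] (hXY : X ≠ Y) (f : Finset V → M) :
    ∑ Z ∈ (mergeParts P hX hY).parts, f Z + (f X + f Y) = ∑ Z ∈ P.parts, f Z + f (X ∪ Y) := by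
  have hnotMem : X ∪ Y ∉ (P.parts.erase X).erase Y := by
    intro hmem
    obtain ⟨-, hX', hmem⟩ := by simpa only [mem_erase] using hmem
    obtain ⟨v, hv⟩ := P.nonempty_of_mem_parts hX
    exact hX' (P.eq_of_mem_parts hmem hX (mem_union_left _ hv) hv)
  rw [parts_mergeParts, sum_insert hnotMem, ← add_sum_erase _ f hX,
    ← add_sum_erase _ f (mem_erase.2 ⟨hXY.symm, hY⟩)]
  ac_rfl

theorem card_parts_mergeParts (hXY : X ≠ Y) :
    (mergeParts P hX hY).parts.card + 1 = P.parts.card := by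
  have := sum_mergeParts hX hY hXY fun _ ↦ 1
  simp only [← card_eq_sum_ones] at this
  omega

end MergeParts

theorem exists_le_of_mergeParts {U : Finset V} {p : Finset V → ℤ} (hp : IsDemand p) {c c' : ℤ}
    (hc : c ≤ c') {Q P : Finpartition U} (hQP : Q ≤ P) {x y : Finset V} (hx : x ∈ Q.parts)
    (hy : y ∈ Q.parts) (hxy : x ≠ y) :
    ∃ R, P ≤ R ∧ mergeParts Q hx hy ≤ R ∧
      totalExcess p c' P + totalExcess p c (mergeParts Q hx hy) ≤
        totalExcess p c Q + totalExcess p c' R := by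
  obtain ⟨X, hX, hxX⟩ := hQP hx
  obtain ⟨Y, hY, hyY⟩ := hQP hy
  have hQ := sum_mergeParts hx hy hxy fun Z ↦ max (p Z - c) 0
  simp only [totalExcess]
  by_cases hXY : X = Y
  · refine ⟨P, le_rfl, mergeParts_le hx hy hQP hX (union_subset hxX (hXY ▸ hyY)), ?_⟩
    have := hp.max_sub_union_le c x y
    linarith
  · refine ⟨mergeParts P hX hY, le_mergeParts hX hY,
      mergeParts_le hx hy (hQP.trans (le_mergeParts hX hY)) (mem_insert_self _ _)
        (union_subset_union hxX hyY), ?_⟩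
    have hP := sum_mergeParts hX hY hXY fun Z ↦ max (p Z - c') 0
    have := hp.max_sub_add_le_of_disjoint hc hxX hyY (P.disjoint hX hY hXY)
    linarith

theorem exists_ne_subset_of_not_le {U : Finset V} {Q P : Finpartition U} (hQP : Q ≤ P)
    (hPQ : ¬ P ≤ Q) :
    ∃ Z ∈ P.parts, ∃ x ∈ Q.parts, ∃ y ∈ Q.parts, x ≠ y ∧ x ∪ y ⊆ Z := by
  have hZ : ∃ Z ∈ P.parts, ∀ x ∈ Q.parts, ¬ Z ⊆ x := by
    contrapose! hPQ
    exact fun Z hZ ↦ hPQ Z hZ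
  have hpart : ∀ {Z}, Z ∈ P.parts → ∀ v ∈ Z, ∃ x ∈ Q.parts, v ∈ x ∧ x ⊆ Z := by
    intro Z hZ v hv
    obtain ⟨x, hx, hvx⟩ := Q.exists_mem (P.subset hZ hv)
    obtain ⟨Z', hZ', hxZ'⟩ := hQP hx
    exact ⟨x, hx, hvx, P.eq_of_mem_parts hZ hZ' hv (hxZ' hvx) ▸ hxZ'⟩
  obtain ⟨Z, hZ, hsplit⟩ := hZ
  obtain ⟨v, hv⟩ := P.nonempty_of_mem_parts hZ
  obtain ⟨x, hx, -, hxZ⟩ := hpart hZ v hv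
  obtain ⟨w, hw, hwx⟩ := not_subset.1 (hsplit x hx)
  obtain ⟨y, hy, hwy, hyZ⟩ := hpart hZ w hw
  exact ⟨Z, hZ, x, hx, y, hy, fun hxy ↦ hwx (hxy ▸ hwy), union_subset hxZ hyZ⟩

-- Merging two parts of `Q` that lie in one part of `P'`, and the parts of `P` around them, never
-- decreases the difference of the two sides; repeat until `Q` has become `P'`.
theorem exists_totalExcess_add_le {U : Finset V} {p : Finset V → ℤ} (hp : IsDemand p) {c c' : ℤ}
    (hc : c ≤ c') {Q P P' : Finpartition U} (hQP : Q ≤ P) (hQP' : Q ≤ P') :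
    ∃ R, P ≤ R ∧ P' ≤ R ∧
      totalExcess p c' P + totalExcess p c P' ≤ totalExcess p c Q + totalExcess p c' R := by
  induction hn : Q.parts.card using Nat.strong_induction_on generalizing Q P with
  | h n ih =>
    by_cases hle : P' ≤ Q
    · obtain rfl : P' = Q := le_antisymm hle hQP'
      exact ⟨P, le_rfl, hQP, (add_comm _ _).le⟩
    obtain ⟨Z, hZ, x, hx, y, hy, hxy, hxyZ⟩ := exists_ne_subset_of_not_le hQP' hle
    obtain ⟨P₁, hPP₁, hQP₁, hle₁⟩ := exists_le_of_mergeParts hp hc hQP hx hy hxy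
    have hcard := card_parts_mergeParts hx hy hxy
    obtain ⟨R, hP₁R, hP'R, hleR⟩ :=
      ih _ (by omega) hQP₁ (mergeParts_le hx hy hQP' hZ hxyZ) rfl
    exact ⟨R, hPP₁.trans hP₁R, hP'R, by linarith⟩

variable {E : Type*}

/-- The number of hyperedges in `F`, with vertex sets given by `A`, that no part of `P` contains. -/
def splitCount {U : Finset V} (F : Finset E) (A : E → Finset V) (P : Finpartition U) : ℕ :=
  (F.filter fun e ↦ ∀ X ∈ P.parts, ¬ A e ⊆ X).card

theorem subset_part_inf {U : Finset V} {P P' : Finpartition U} {B : Finset V}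
    (hP : ∃ X ∈ P.parts, B ⊆ X) (hP' : ∃ X ∈ P'.parts, B ⊆ X) : ∃ X ∈ (P ⊓ P').parts, B ⊆ X := by
  obtain ⟨X, hX, hBX⟩ := hP
  obtain ⟨X', hX', hBX'⟩ := hP'
  rcases B.eq_empty_or_nonempty with rfl | ⟨v, hv⟩
  · obtain ⟨Z, hZ⟩ := (P ⊓ P').parts_nonempty
      ((P.nonempty_of_mem_parts hX).mono (P.subset hX)).ne_empty
    exact ⟨Z, hZ, empty_subset _⟩
  · refine ⟨X ∩ X', ?_, subset_inter hBX hBX'⟩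
    rw [Finpartition.parts_inf, mem_erase, mem_image]
    exact ⟨(nonempty_iff_ne_empty.1 ⟨v, mem_inter.2 ⟨hBX hv, hBX' hv⟩⟩),
      (X, X'), mem_product.2 ⟨hX, hX'⟩, rfl⟩

theorem splitCount_inf_add_le {U : Finset V} (F : Finset E) (A : E → Finset V)
    {P P' R : Finpartition U} (hP : P ≤ R) (hP' : P' ≤ R) :
    splitCount F A (P ⊓ P') + splitCount F A R ≤ splitCount F A P + splitCount F A P' := by
  classical
  have mono : ∀ {Q}, Q ≤ R → ∀ e, (∀ X ∈ R.parts, ¬ A e ⊆ X) → ∀ X ∈ Q.parts, ¬ A e ⊆ X := by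
    intro Q hQ e he X hX heX
    obtain ⟨Z, hZ, hXZ⟩ := hQ hX
    exact he Z hZ (heX.trans hXZ)
  simp only [splitCount]
  rw [← card_union_add_card_inter (F.filter fun e ↦ ∀ X ∈ P.parts, ¬ A e ⊆ X)]
  refine add_le_add (card_le_card ?_) (card_le_card ?_)
  · rw [← filter_or]
    refine monotone_filter_right F fun e _ he ↦ ?_
    by_contra! hsub
    obtain ⟨Z, hZ, heZ⟩ := subset_part_inf hsub.1 hsub.2
    exact he Z hZ heZ
  · rw [← filter_and]
    exact monotone_filter_right F fun e _ he ↦ ⟨mono hP e he, mono hP' e he⟩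

theorem splitCount_erase_add_one [DecidableEq E] {U : Finset V} {F : Finset E} {A : E → Finset V}
    {P : Finpartition U} {e : E} (he : e ∈ F) (hsplit : ∀ X ∈ P.parts, ¬ A e ⊆ X) :
    splitCount (F.erase e) A P + 1 = splitCount F A P := by
  rw [splitCount, filter_erase]
  exact card_erase_add_one (mem_filter.2 ⟨he, hsplit⟩)

theorem splitCount_erase_of_subset [DecidableEq E] {U : Finset V} {F : Finset E} {A : E → Finset V}
    {P : Finpartition U} {e : E} (hsub : ∃ X ∈ P.parts, A e ⊆ X) :
    splitCount (F.erase e) A P = splitCount F A P := by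
  obtain ⟨X, hX, heX⟩ := hsub
  rw [splitCount, filter_erase, erase_eq_of_notMem, splitCount]
  exact fun he ↦ (mem_filter.1 he).2 X hX heX

section Covers

variable {ι : Type*} [DecidableEq ι]

/-- The covering condition for splitting `F` into branchings that meet the demand `p` when the
branchings in `T` still have to receive their roots, `ℓ i` of them each: for every `J ⊆ T` and every
partition of `U`, the excess demand over `J.card` is covered by the hyperedges the partition splits
and by the roots of the branchings outside `J`. Letting `J` vary linearizes the minima
`min (ℓ i) P.parts.card`. -/
def Covers (U : Finset V) (F : Finset E) (A : E → Finset V) (p : Finset V → ℤ) (ℓ : ι → ℕ)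
    (T : Finset ι) : Prop :=
  ∀ J ⊆ T, ∀ P : Finpartition U,
    totalExcess p J.card P ≤ (splitCount F A P : ℤ) + ∑ i ∈ T \ J, (ℓ i : ℤ)

/-- The pair `(J, P)` attains equality in `Covers`. -/
def IsTightPair {U : Finset V} (F : Finset E) (A : E → Finset V) (p : Finset V → ℤ) (ℓ : ι → ℕ)
    (T J : Finset ι) (P : Finpartition U) : Prop :=
  J ⊆ T ∧ totalExcess p J.card P = (splitCount F A P : ℤ) + ∑ i ∈ T \ J, (ℓ i : ℤ)

variable {U : Finset V} {F : Finset E} {A : E → Finset V} {p : Finset V → ℤ} {ℓ : ι → ℕ}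
  {T : Finset ι}

theorem Covers.exists_isTightPair_inf (hp : IsDemand p) (hcov : Covers U F A p ℓ T)
    {J J' : Finset ι} {P P' : Finpartition U} (h : IsTightPair F A p ℓ T J P)
    (h' : IsTightPair F A p ℓ T J' P') :
    ∃ M, IsTightPair F A p ℓ T M (P ⊓ P') ∧ M.card ≤ J.card ∧ M.card ≤ J'.card := by
  wlog hJ : J'.card ≤ J.card generalizing J J' P P'
  · obtain ⟨M, hM, hMJ', hMJ⟩ := this h' h (le_of_not_ge hJ)
    exact ⟨M, inf_comm P P' ▸ hM, hMJ, hMJ'⟩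
  obtain ⟨R, hPR, hP'R, hle⟩ := exists_totalExcess_add_le hp (Nat.cast_le.2 hJ)
    (inf_le_left : P ⊓ P' ≤ P) (inf_le_right : P ⊓ P' ≤ P')
  have hsplit := splitCount_inf_add_le F A hPR hP'R
  have hinf := hcov J' h'.1 (P ⊓ P')
  have hR := hcov J h.1 R
  refine ⟨J', ⟨h'.1, ?_⟩, hJ, le_rfl⟩
  have ht := h.2
  have ht' := h'.2
  omega

theorem Covers.exists_isTightPair_forall_le (hp : IsDemand p) (hcov : Covers U F A p ℓ T)
    {α : Type*} {s : Finset α} (hs : s.Nonempty) {J : α → Finset ι} {P : α → Finpartition U}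
    (ht : ∀ a ∈ s, IsTightPair F A p ℓ T (J a) (P a)) :
    ∃ M Q, IsTightPair F A p ℓ T M Q ∧ ∀ a ∈ s, M.card ≤ (J a).card ∧ Q ≤ P a := by
  induction hs using Finset.Nonempty.cons_induction with
  | singleton a =>
    simp only [mem_singleton, forall_eq] at ht ⊢
    exact ⟨J a, P a, ht, le_rfl, le_rfl⟩
  | cons a s _ _ ih =>
    simp only [forall_mem_cons] at ht ⊢
    obtain ⟨M, Q, hMQ, hle⟩ := ih ht.2
    obtain ⟨N, hN, hNa, hNM⟩ := hcov.exists_isTightPair_inf hp ht.1 hMQ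
    exact ⟨N, P a ⊓ Q, hN, ⟨hNa, inf_le_left⟩, fun b hb ↦
      ⟨hNM.trans (hle b hb).1, inf_le_right.trans (hle b hb).2⟩⟩

theorem Covers.exists_isTightPair_of_not_erase [DecidableEq E] (hcov : Covers U F A p ℓ T) {e : E}
    (he : e ∈ F) (hnot : ¬ Covers U (F.erase e) A p ℓ T) :
    ∃ (J : Finset ι) (P : Finpartition U), IsTightPair F A p ℓ T J P ∧
      ∀ X ∈ P.parts, ¬ A e ⊆ X := by
  simp only [Covers, not_forall, not_le] at hnot
  obtain ⟨J, hJ, P, hlt⟩ := hnot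
  have hle := hcov J hJ P
  by_cases hsplit : ∀ X ∈ P.parts, ¬ A e ⊆ X
  · have := splitCount_erase_add_one he hsplit
    exact ⟨J, P, ⟨hJ, by omega⟩, hsplit⟩
  · push Not at hsplit
    rw [splitCount_erase_of_subset hsplit] at hlt
    omega

theorem totalExcess_const (h c : ℤ) (P : Finpartition U) :
    totalExcess (fun _ ↦ h) c P = P.parts.card * max (h - c) 0 := by
  rw [totalExcess, sum_const, nsmul_eq_mul]

theorem Covers.mul_card_le {h : ℕ} (hcov : Covers U F A (fun _ ↦ h) ℓ T) :
    h * U.card ≤ F.card + ∑ i ∈ T, ℓ i := by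
  have hbot := hcov ∅ (empty_subset T) ⊥
  rw [totalExcess_const, card_empty, Finpartition.card_bot, sdiff_empty, Nat.cast_zero, sub_zero,
    max_eq_left (Nat.cast_nonneg h)] at hbot
  have hsplit : splitCount F A (⊥ : Finpartition U) ≤ F.card := card_filter_le _ _
  zify at hsplit ⊢
  linarith

theorem IsTightPair.card_add_sum_le {h : ℕ} (hℓ : ∀ i ∈ T, ℓ i ≤ U.card) {J : Finset ι}
    {P : Finpartition U} (ht : IsTightPair F A (fun _ ↦ h) ℓ T J P) (hF : F.Nonempty)
    (hsplit : ∀ e ∈ F, ∀ X ∈ P.parts, ¬ A e ⊆ X) : F.card + ∑ i ∈ T, ℓ i ≤ h * U.card := by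
  obtain ⟨hJT, ht⟩ := ht
  rw [totalExcess_const, splitCount, filter_true_of_mem hsplit] at ht
  have hsum : ∑ i ∈ T \ J, (ℓ i : ℤ) + ∑ i ∈ J, (ℓ i : ℤ) = ∑ i ∈ T, (ℓ i : ℤ) := sum_sdiff hJT
  have hpos : (0 : ℤ) ≤ ∑ i ∈ T \ J, (ℓ i : ℤ) := sum_nonneg fun i _ ↦ Nat.cast_nonneg _
  have hFpos : 0 < F.card := hF.card_pos
  have hJh : J.card < h := by
    by_contra hle
    rw [max_eq_right (by omega), mul_zero] at ht
    omega
  rw [max_eq_left (by omega)] at ht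
  have hP : (P.parts.card : ℤ) * (h - J.card) ≤ U.card * (h - J.card) :=
    mul_le_mul_of_nonneg_right (by exact_mod_cast P.card_parts_le_card) (by omega)
  have hJ : ∑ i ∈ J, (ℓ i : ℤ) ≤ J.card * U.card := by
    rw [← nsmul_eq_mul]
    exact sum_le_card_nsmul _ _ _ fun i hi ↦ by exact_mod_cast hℓ i (hJT hi)
  zify
  linarith

theorem Covers.exists_subset_card_add_sum_eq {h : ℕ} (hℓ : ∀ i ∈ T, ℓ i ≤ U.card)
    (hsum : ∑ i ∈ T, ℓ i ≤ h * U.card) (hcov : Covers U F A (fun _ ↦ h) ℓ T) :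
    ∃ F' ⊆ F, Covers U F' A (fun _ ↦ h) ℓ T ∧ F'.card + ∑ i ∈ T, ℓ i = h * U.card := by
  classical
  obtain ⟨F', hF'F, hmin⟩ := exists_minimal_le_of_wellFoundedLT
    (fun F ↦ Covers U F A (fun _ ↦ h) ℓ T) F hcov
  refine ⟨F', hF'F, hmin.prop, le_antisymm ?_ hmin.prop.mul_card_le⟩
  rcases F'.eq_empty_or_nonempty with rfl | hF'
  · simpa using hsum
  have htight : ∀ e ∈ F', ∃ JP : Finset ι × Finpartition U,
      IsTightPair F' A (fun _ ↦ h) ℓ T JP.1 JP.2 ∧ ∀ X ∈ JP.2.parts, ¬ A e ⊆ X := fun e he ↦ by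
    simpa only [Prod.exists] using hmin.prop.exists_isTightPair_of_not_erase he
      (hmin.not_prop_of_lt (erase_ssubset he))
  choose! JP hJP hsplit using htight
  obtain ⟨M, Q, hMQ, hle⟩ :=
    hmin.prop.exists_isTightPair_forall_le (isDemand_const _) hF' hJP
  refine hMQ.card_add_sum_le hℓ hF' fun e he X hX heX ↦ ?_
  obtain ⟨Z, hZ, hXZ⟩ := (hle e he).2 hX
  exact hsplit e he Z hZ (heX.trans hXZ)

end Covers

section RootPlacement

/-- The indicator of `X` meeting `S`: the demand of `X` served by the roots in `S`. -/
def hit (S X : Finset V) : ℤ :=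
  if (S ∩ X).Nonempty then 1 else 0

theorem hit_eq_one {S X : Finset V} (hSX : (S ∩ X).Nonempty) : hit S X = 1 :=
  if_pos hSX

theorem hit_nonneg (S X : Finset V) : 0 ≤ hit S X := by
  unfold hit
  split_ifs <;> simp

theorem hit_mono {S S' X X' : Finset V} (hS : S ⊆ S') (hX : X ⊆ X') : hit S X ≤ hit S' X' := by
  have := Finset.Nonempty.mono (inter_subset_inter hS hX)
  unfold hit
  split_ifs <;> simp_all

theorem hit_inter_add_hit_union_le (S X Y : Finset V) :
    hit S (X ∩ Y) + hit S (X ∪ Y) ≤ hit S X + hit S Y := by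
  have hX : hit S (X ∩ Y) ≤ hit S X := hit_mono subset_rfl inter_subset_left
  have hY : hit S (X ∩ Y) ≤ hit S Y := hit_mono subset_rfl inter_subset_right
  have hunion : (S ∩ (X ∪ Y)).Nonempty ↔ (S ∩ X).Nonempty ∨ (S ∩ Y).Nonempty := by
    rw [inter_union_distrib_left, union_nonempty]
  unfold hit at *
  split_ifs at * <;> first | omega | tauto

theorem hit_erase_of_notMem {S X : Finset V} {v : V} (hv : v ∉ X) :
    hit (S.erase v) X = hit S X := by
  rw [hit, erase_inter, erase_eq_of_notMem fun h ↦ hv (mem_inter.1 h).2, hit]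

theorem IsDemand.sub_hit {p : Finset V → ℤ} (hp : IsDemand p) (S : Finset V) :
    IsDemand fun X ↦ p X - hit S X where
  antitone X Y hXY := sub_le_sub (hp.antitone hXY) (hit_mono subset_rfl hXY)
  supermodular X Y := by
    have := hp.supermodular X Y
    have := hit_inter_add_hit_union_le S X Y
    omega

theorem sum_card_inter_parts {U : Finset V} (P : Finpartition U) {S : Finset V} (hS : S ⊆ U) :
    ∑ X ∈ P.parts, (S ∩ X).card = S.card := by
  have hdisj : (P.parts : Set (Finset V)).PairwiseDisjoint (S ∩ ·) := fun X hX Y hY hXY ↦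
    (P.disjoint hX hY hXY).mono inter_subset_right inter_subset_right
  have hunion : P.parts.biUnion (S ∩ ·) = S := by
    conv_rhs => rw [← inter_eq_left.2 hS, ← P.biUnion_parts, inter_biUnion]
    rfl
  rw [← card_biUnion hdisj, hunion]

theorem part_subset_part_of_le {U : Finset V} {P Q : Finpartition U} (hPQ : P ≤ Q) (v : V) :
    P.part v ⊆ Q.part v := by
  intro w hw
  obtain ⟨X, hX, hwX, hvX⟩ := P.mem_part_iff_exists.1 hw
  obtain ⟨Y, hY, hXY⟩ := hPQ hX
  exact Q.mem_part_iff_exists.2 ⟨Y, hY, hXY hwX, hXY hvX⟩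

variable {E ι : Type*} [DecidableEq ι] {U : Finset V} {F : Finset E} {A : E → Finset V}
  {p : Finset V → ℤ} {ℓ : ι → ℕ} {T : Finset ι}

theorem Covers.exists_isTightPair_of_not_sub_hit_erase {S : Finset V} {v : V}
    (hcov : Covers U F A (fun X ↦ p X - hit S X) ℓ T)
    (hnot : ¬ Covers U F A (fun X ↦ p X - hit (S.erase v) X) ℓ T) :
    ∃ (J : Finset ι) (P : Finpartition U), IsTightPair F A (fun X ↦ p X - hit S X) ℓ T J P ∧
      hit (S.erase v) (P.part v) = 0 ∧ J.card < p (P.part v) := by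
  simp only [Covers, not_forall, not_le] at hnot
  obtain ⟨J, hJ, P, hlt⟩ := hnot
  have hle := hcov J hJ P
  obtain ⟨X, hX, hltX⟩ := exists_lt_of_sum_lt (hle.trans_lt hlt)
  have hvX : v ∈ X := by
    by_contra hvX
    simp only [hit_erase_of_notMem hvX] at hltX
    exact hltX.false
  have hother : ∑ Y ∈ P.parts.erase X, max (p Y - hit (S.erase v) Y - J.card) 0 =
      ∑ Y ∈ P.parts.erase X, max (p Y - hit S Y - J.card) 0 :=
    sum_congr rfl fun Y hY ↦ by
      rw [hit_erase_of_notMem]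
      exact fun hvY ↦ (mem_erase.1 hY).1 (P.eq_of_mem_parts (mem_erase.1 hY).2 hX hvY hvX)
  have hhit : hit (S.erase v) X = 0 ∧ hit S X = 1 := by
    unfold hit at hltX ⊢
    split_ifs at hltX ⊢ <;> simp_all
  rw [totalExcess, ← add_sum_erase _ _ hX] at hle hlt
  refine ⟨J, P, ⟨hJ, ?_⟩, ?_⟩
  · rw [totalExcess, ← add_sum_erase _ _ hX]
    omega
  · rw [P.part_eq_of_mem hX hvX]
    exact ⟨hhit.1, by omega⟩

theorem totalExcess_sub_hit_add_card_le {S : Finset V} (hS : S ⊆ U) {c : ℤ} {P : Finpartition U}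
    (hP : ∀ v ∈ S, hit (S.erase v) (P.part v) = 0 ∧ c < p (P.part v)) :
    totalExcess (fun X ↦ p X - hit S X) c P + S.card ≤ totalExcess p c P := by
  rw [← sum_card_inter_parts P hS, totalExcess, totalExcess, Nat.cast_sum, ← sum_add_distrib]
  refine sum_le_sum fun X hX ↦ ?_
  rcases (S ∩ X).eq_empty_or_nonempty with hSX | ⟨v, hv⟩
  · simp [hit, hSX]
  · obtain ⟨hvS, hvX⟩ := mem_inter.1 hv
    obtain ⟨hhit, hlt⟩ := P.part_eq_of_mem hX hvX ▸ hP v hvS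
    have hcard : (S ∩ X).card = 1 := by
      have hempty : (S ∩ X).erase v = ∅ := by
        rw [← erase_inter, ← not_nonempty_iff_eq_empty]
        intro hne
        rw [hit_eq_one hne] at hhit
        omega
      rw [← card_erase_add_one hv, hempty, card_empty]
    rw [hit_eq_one ⟨v, hv⟩]
    omega

theorem Covers.sub_hit_self {j : ι} (hj : j ∉ T) (hcov : Covers U F A p ℓ (insert j T)) :
    Covers U F A (fun X ↦ p X - hit U X) ℓ T := by
  intro J hJ P
  have hjJ := hcov (insert j J) (insert_subset_insert j hJ) P
  rw [insert_sdiff_insert, sdiff_insert_of_notMem hj, card_insert_of_notMem fun h ↦ hj (hJ h)]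
    at hjJ
  refine (sum_le_sum fun X hX ↦ ?_).trans hjJ
  have hhit : hit U X = 1 :=
    hit_eq_one ((inter_eq_right.2 (P.subset hX)).symm ▸ P.nonempty_of_mem_parts hX)
  simp only [hhit, Nat.cast_add, Nat.cast_one, sub_sub, add_comm, le_refl]

theorem Covers.exists_card_le_sub_hit (hp : IsDemand p) {j : ι} (hj : j ∉ T)
    (hcov : Covers U F A p ℓ (insert j T)) :
    ∃ S ⊆ U, S.card ≤ ℓ j ∧ Covers U F A (fun X ↦ p X - hit S X) ℓ T := by
  obtain ⟨S, hSU, hmin⟩ := exists_minimal_le_of_wellFoundedLT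
    (fun S ↦ Covers U F A (fun X ↦ p X - hit S X) ℓ T) U (hcov.sub_hit_self hj)
  refine ⟨S, hSU, ?_, hmin.prop⟩
  rcases S.eq_empty_or_nonempty with rfl | hS
  · simp
  have htight : ∀ v ∈ S, ∃ JP : Finset ι × Finpartition U,
      IsTightPair F A (fun X ↦ p X - hit S X) ℓ T JP.1 JP.2 ∧
        hit (S.erase v) (JP.2.part v) = 0 ∧ JP.1.card < p (JP.2.part v) := fun v hv ↦ by
    simpa only [Prod.exists] using hmin.prop.exists_isTightPair_of_not_sub_hit_erase
      (hmin.not_prop_of_lt (erase_ssubset hv))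
  choose! JP hJP hpart using htight
  obtain ⟨J, P, ⟨hJT, heq⟩, hle⟩ :=
    hmin.prop.exists_isTightPair_forall_le (hp.sub_hit S) hS hJP
  have hP : ∀ v ∈ S, hit (S.erase v) (P.part v) = 0 ∧ J.card < p (P.part v) := fun v hv ↦ by
    obtain ⟨hhit, hlt⟩ := hpart v hv
    have hsub := part_subset_part_of_le (hle v hv).2 v
    have hJv : (J.card : ℤ) ≤ (JP v).1.card := by exact_mod_cast (hle v hv).1
    exact ⟨le_antisymm (hhit ▸ hit_mono subset_rfl hsub) (hit_nonneg _ _),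
      (hJv.trans_lt hlt).trans_le (hp.antitone hsub)⟩
  have hcount := totalExcess_sub_hit_add_card_le hSU hP
  have hJ := hcov J (hJT.trans (subset_insert j T)) P
  rw [insert_sdiff_of_notMem _ fun h ↦ hj (hJT h),
    sum_insert fun h ↦ hj (mem_sdiff.1 h).1] at hJ
  omega

theorem Covers.exists_roots (hp : IsDemand p) (hℓ : ∀ i ∈ T, ℓ i ≤ U.card)
    (hcov : Covers U F A p ℓ T) :
    ∃ S : ι → Finset V, (∀ i ∈ T, S i ⊆ U ∧ (S i).card = ℓ i) ∧
      Covers U F A (fun X ↦ p X - ∑ i ∈ T, hit (S i) X) ℓ ∅ := by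
  induction T using Finset.induction_on generalizing p with
  | empty => exact ⟨fun _ ↦ ∅, by simp, by simpa using hcov⟩
  | insert j T hj ih =>
    simp only [forall_mem_insert] at hℓ ⊢
    obtain ⟨R₀, hR₀U, hR₀, hcov₀⟩ := hcov.exists_card_le_sub_hit hp hj
    obtain ⟨R, hR₀R, hRU, hR⟩ := exists_subsuperset_card_eq hR₀U hR₀ hℓ.1
    have hcovR : Covers U F A (fun X ↦ p X - hit R X) ℓ T := fun J hJ P ↦
      (sum_le_sum fun X _ ↦ max_le_max (sub_le_sub_right
        (sub_le_sub_left (hit_mono hR₀R subset_rfl) _) _) le_rfl).trans (hcov₀ J hJ P)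
    obtain ⟨S, hS, hcovS⟩ := ih (hp.sub_hit R) hℓ.2 hcovR
    have hne : ∀ i ∈ T, i ≠ j := fun i hi h ↦ hj (h ▸ hi)
    have hsum : ∀ X, ∑ i ∈ insert j T, hit (Function.update S j R i) X =
        hit R X + ∑ i ∈ T, hit (S i) X := fun X ↦ by
      rw [sum_insert hj, Function.update_self]
      exact congrArg _ (sum_congr rfl fun i hi ↦ by rw [Function.update_of_ne (hne i hi)])
    refine ⟨Function.update S j R, ⟨by rw [Function.update_self]; exact ⟨hRU, hR⟩,
      fun i hi ↦ by rw [Function.update_of_ne (hne i hi)]; exact hS i hi⟩, ?_⟩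
    simpa only [hsum, sub_sub] using hcovS

end RootPlacement

section Sparse

variable {E K : Type*} [Fintype K]

/-- The branchings, with root sets `S i`, that have a root in `X`. -/
def colors (S : K → Finset V) (X : Finset V) : Finset K :=
  univ.filter fun i ↦ (S i ∩ X).Nonempty

/-- The hyperedges in `F`, with vertex sets given by `A`, that are contained in `X`. -/
def spanned (F : Finset E) (A : E → Finset V) (X : Finset V) : Finset E :=
  F.filter fun e ↦ A e ⊆ X

/-- The number of the `h * X.card` in-arcs and root incidences due in `X` that are accounted for: by
hyperedges inside `X`, by roots in `X`, and by the branchings that still have to enter `X`. The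
subtraction is meant to be truncated. -/
def load (F : Finset E) (A : E → Finset V) (S : K → Finset V) (h : ℕ) (X : Finset V) : ℕ :=
  (spanned F A X).card + ∑ v ∈ X, (colors S {v}).card + (h - (colors S X).card)

/-- The condition under which `F` can be split into branchings with root sets `S i` in which every
vertex of `U` has `h` in-arcs and root incidences altogether. -/
structure IsSparse (U : Finset V) (F : Finset E) (A : E → Finset V) (S : K → Finset V) (h : ℕ) :
    Prop where
  load_le : ∀ X ⊆ U, X.Nonempty → load F A S h X ≤ h * X.card
  card_add_sum_eq : F.card + ∑ v ∈ U, (colors S {v}).card = h * U.card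

variable {U X Y Z : Finset V} {F : Finset E} {A : E → Finset V} {S : K → Finset V} {h : ℕ}

theorem mem_colors {i : K} : i ∈ colors S X ↔ (S i ∩ X).Nonempty := by
  simp only [colors, mem_filter_univ]

theorem mem_colors_singleton {i : K} {v : V} : i ∈ colors S {v} ↔ v ∈ S i := by
  simp only [mem_colors, Finset.Nonempty, mem_inter, mem_singleton, exists_eq_right]

theorem colors_mono (hXY : X ⊆ Y) : colors S X ⊆ colors S Y :=
  monotone_filter_right _ fun _ _ hX ↦ hX.mono (inter_subset_inter_left hXY)

theorem colors_union [DecidableEq K] : colors S (X ∪ Y) = colors S X ∪ colors S Y := by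
  ext i
  simp only [mem_union, mem_colors, inter_union_distrib_left, union_nonempty]

theorem card_colors : ((colors S X).card : ℤ) = ∑ i, hit (S i) X := by
  simp only [colors, hit, card_filter, Nat.cast_sum, Nat.cast_ite, Nat.cast_one, Nat.cast_zero]

theorem sum_card_colors_singleton (hS : ∀ i, S i ⊆ U) :
    ∑ v ∈ U, (colors S {v}).card = ∑ i, (S i).card := by
  classical
  have hroots := sum_card_bipartiteAbove_eq_sum_card_bipartiteBelow (s := U) (t := univ)
    fun v i ↦ v ∈ S i
  have hcolors : ∀ v, colors S {v} = univ.bipartiteAbove (fun v i ↦ v ∈ S i) v := fun v ↦ by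
    ext i
    simp only [mem_colors_singleton, mem_bipartiteAbove, mem_univ, true_and]
  simp only [hcolors, hroots, bipartiteBelow]
  exact sum_congr rfl fun i _ ↦ by rw [filter_mem_eq_inter, inter_eq_right.2 (hS i)]

theorem splitCount_add_card_spanned_le {P : Finpartition U} (hX : X ∈ P.parts) :
    splitCount F A P + (spanned F A X).card ≤ F.card := by
  rw [← card_filter_add_card_filter_not (s := F) (fun e ↦ A e ⊆ X), add_comm, spanned, splitCount]
  exact Nat.add_le_add_left
    (card_le_card (monotone_filter_right F fun e _ he ↦ he X hX)) _

-- Apply the covering condition to the partition of `U` into `X` and singletons.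
theorem Covers.isSparse [DecidableEq K] {ℓ : K → ℕ}
    (hcov : Covers U F A (fun X ↦ h - ∑ i, hit (S i) X) ℓ ∅) (hS : ∀ i, S i ⊆ U)
    (hcard : F.card + ∑ i, (S i).card = h * U.card) : IsSparse U F A S h := by
  rw [← sum_card_colors_singleton hS] at hcard
  refine ⟨fun X hXU hX ↦ ?_, hcard⟩
  let P : Finpartition U := (⊥ : Finpartition (U \ X)).extend hX.ne_empty sdiff_disjoint
    (sdiff_union_of_subset hXU)
  have hP : ∀ f : Finset V → ℤ, ∑ Y ∈ P.parts, f Y = f X + ∑ v ∈ U \ X, f {v} := by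
    intro f
    rw [Finpartition.extend_parts, sum_insert, Finpartition.parts_bot, sum_map]
    · rfl
    · intro hmem
      obtain ⟨v, hv⟩ := hX
      exact (mem_sdiff.1 (Finpartition.subset _ hmem hv)).2 hv
  have hle := hcov ∅ subset_rfl P
  simp only [totalExcess, hP, ← card_colors, card_empty, Nat.cast_zero, sub_zero, sdiff_empty,
    sum_empty, add_zero] at hle
  have hsplit := splitCount_add_card_spanned_le (F := F) (A := A) (P := P)
    (mem_insert_self X (⊥ : Finpartition (U \ X)).parts)
  have hsingle : ∑ v ∈ U \ X, ((h : ℤ) - (colors S {v}).card) ≤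
      ∑ v ∈ U \ X, max ((h : ℤ) - (colors S {v}).card) 0 := sum_le_sum fun _ _ ↦ le_max_left _ _
  rw [sum_sub_distrib, sum_const, nsmul_eq_mul] at hsingle
  have hU : (U \ X).card + X.card = U.card := card_sdiff_add_card_eq_card hXU
  have hsum := sum_sdiff hXU (f := fun v ↦ (colors S {v}).card)
  rw [← hU, mul_add] at hcard
  have htrunc : max ((h : ℤ) - (colors S X).card) 0 = (h - (colors S X).card : ℕ) := by omega
  rw [load]
  zify at hcard hsum hsplit ⊢
  linarith

theorem card_spanned_add_le (F : Finset E) (A : E → Finset V) (X Y : Finset V) :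
    (spanned F A X).card + (spanned F A Y).card ≤
      (spanned F A (X ∩ Y)).card + (spanned F A (X ∪ Y)).card := by
  classical
  have hinter : spanned F A X ∩ spanned F A Y = spanned F A (X ∩ Y) := by
    simp only [spanned, ← filter_and, subset_inter_iff]
  have hunion : spanned F A X ∪ spanned F A Y ⊆ spanned F A (X ∪ Y) := by
    simp only [spanned, ← filter_or]
    exact monotone_filter_right _ fun e _ ↦
      Or.rec (·.trans subset_union_left) (·.trans subset_union_right)
  rw [← card_union_add_card_inter, hinter, add_comm]
  exact Nat.add_le_add_left (card_le_card hunion) _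

theorem card_colors_add_le [DecidableEq K] (S : K → Finset V) (X Y : Finset V) :
    (colors S X ∩ colors S Y).card + (colors S (X ∪ Y)).card ≤
      (colors S X).card + (colors S Y).card := by
  rw [colors_union, add_comm, card_union_add_card_inter]

/-- Equality in the sparsity condition. -/
def IsTight (F : Finset E) (A : E → Finset V) (S : K → Finset V) (h : ℕ) (X : Finset V) : Prop :=
  load F A S h X = h * X.card

-- All three parts of the load are supermodular, so each of them is modular on two intersecting
-- tight sets.
theorem IsSparse.isTight_inter (hsp : IsSparse U F A S h) (hXU : X ⊆ U) (hYU : Y ⊆ U)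
    (hX : IsTight F A S h X) (hY : IsTight F A S h Y) (hXY : (X ∩ Y).Nonempty) :
    IsTight F A S h (X ∩ Y) ∧
      (h - (colors S (X ∩ Y)).card) + (h - (colors S (X ∪ Y)).card) =
        (h - (colors S X).card) + (h - (colors S Y).card) := by
  classical
  have hinter := hsp.load_le _ (inter_subset_left.trans hXU) hXY
  have hunion := hsp.load_le _ (union_subset hXU hYU)
    (hXY.mono (inter_subset_left.trans subset_union_left))
  have hspanned := card_spanned_add_le F A X Y
  have hcolors := card_colors_add_le S X Y
  have hcolorsInter : (colors S (X ∩ Y)).card ≤ (colors S X ∩ colors S Y).card :=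
    card_le_card (subset_inter (colors_mono inter_subset_left) (colors_mono inter_subset_right))
  have hcolorsX : (colors S X).card ≤ (colors S (X ∪ Y)).card :=
    card_le_card (colors_mono subset_union_left)
  have hcolorsY : (colors S Y).card ≤ (colors S (X ∪ Y)).card :=
    card_le_card (colors_mono subset_union_right)
  have hroots := sum_union_inter (s₁ := X) (s₂ := Y) (f := fun v ↦ (colors S {v}).card)
  have hcard : h * (X ∪ Y).card + h * (X ∩ Y).card = h * X.card + h * Y.card := by
    rw [← mul_add, card_union_add_card_inter, mul_add]
  have hcolorsInterX : (colors S X ∩ colors S Y).card ≤ (colors S X).card :=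
    card_le_card inter_subset_left
  simp only [IsTight, load] at *
  omega

theorem IsSparse.mem_colors_inter (hsp : IsSparse U F A S h) (hXU : X ⊆ U) (hYU : Y ⊆ U)
    (hX : IsTight F A S h X) (hY : IsTight F A S h Y) (hXY : (X ∩ Y).Nonempty) {i : K}
    (hiX : i ∈ colors S X) (hiY : i ∈ colors S Y ∨ h ≤ (colors S Y).card)
    (hlt : (colors S (X ∩ Y)).card < h) : i ∈ colors S (X ∩ Y) := by
  classical
  by_contra hi
  have heq := (hsp.isTight_inter hXU hYU hX hY hXY).2
  have hcolors := card_colors_add_le S X Y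
  have hinterX : colors S (X ∩ Y) ⊆ colors S X := colors_mono inter_subset_left
  have hinterY : colors S (X ∩ Y) ⊆ colors S Y := colors_mono inter_subset_right
  have hX' : (colors S (X ∩ Y)).card + 1 ≤ (colors S X).card := by
    rw [← card_insert_of_notMem hi]
    exact card_le_card (insert_subset hiX hinterX)
  have hcolorsY : (colors S Y).card ≤ (colors S (X ∪ Y)).card :=
    card_le_card (colors_mono subset_union_right)
  rcases hiY with hiY | hhY
  · have hXY' : (colors S (X ∩ Y)).card + 1 ≤ (colors S X ∩ colors S Y).card := by
      rw [← card_insert_of_notMem hi]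
      exact card_le_card
        (insert_subset (mem_inter.2 ⟨hiX, hiY⟩) (subset_inter hinterX hinterY))
    have hY' : (colors S X ∩ colors S Y).card ≤ (colors S Y).card :=
      card_le_card inter_subset_right
    omega
  · omega

/-- A tight set with a vertex that still needs in-arcs of a branching rooted elsewhere in the set.
In a minimal critical set some hyperedge can be used to enlarge a branching. -/
structure IsCritical (U : Finset V) (F : Finset E) (A : E → Finset V) (S : K → Finset V) (h : ℕ)
    (X : Finset V) : Prop where
  subset : X ⊆ U
  isTight : IsTight F A S h X
  exists_unsaturated : ∃ v ∈ X, (colors S {v}).card < h ∧ colors S X ≠ colors S {v}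

theorem IsSparse.isCritical_self (hsp : IsSparse U F A S h) (hF : F.Nonempty)
    (hAU : ∀ e ∈ F, A e ⊆ U) : IsCritical U F A S h U := by
  have heq := hsp.card_add_sum_eq
  have hsum : ∑ v ∈ U, (colors S {v}).card < ∑ _v ∈ U, h := by
    rw [sum_const, smul_eq_mul, mul_comm, ← heq]
    exact Nat.lt_add_of_pos_left hF.card_pos
  obtain ⟨v, hvU, hv⟩ := exists_lt_of_sum_lt hsum
  have hle := hsp.load_le U subset_rfl ⟨v, hvU⟩
  rw [load, spanned, filter_true_of_mem hAU] at hle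
  refine ⟨subset_rfl, ?_, v, hvU, hv, fun hU ↦ ?_⟩
  · rw [IsTight, load, spanned, filter_true_of_mem hAU]
    omega
  · rw [hU] at hle
    omega

theorem IsSparse.isTight_right_of_union (hsp : IsSparse U F A S h) (hYU : Y ⊆ U) (hZU : Z ⊆ U)
    (hY : Y.Nonempty) (hZ : Z.Nonempty) (hYZ : Disjoint Y Z) (htight : IsTight F A S h (Y ∪ Z))
    (hsplit : ∀ e ∈ F, A e ⊆ Y ∪ Z → A e ⊆ Y ∨ A e ⊆ Z) :
    IsTight F A S h Z ∧ h ≤ (colors S Z).card := by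
  classical
  have hspanned : (spanned F A (Y ∪ Z)).card ≤ (spanned F A Y).card + (spanned F A Z).card := by
    refine (card_le_card ?_).trans (card_union_le _ _)
    simp only [spanned, ← filter_or]
    exact monotone_filter_right F hsplit
  have hcolors : (colors S Y).card ≤ (colors S (Y ∪ Z)).card :=
    card_le_card (colors_mono subset_union_left)
  have hleY := hsp.load_le Y hYU hY
  have hleZ := hsp.load_le Z hZU hZ
  simp only [IsTight, load, sum_union hYZ, card_union_of_disjoint hYZ, mul_add] at *
  omega

theorem IsSparse.exists_mem_of_minimal_isCritical (hsp : IsSparse U F A S h)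
    (hX : Minimal (IsCritical U F A S h) X) :
    ∃ e ∈ F, A e ⊆ X ∧ ∃ u ∈ A e, ∃ v ∈ A e, (colors S {v}).card < h ∧
      ∃ i, u ∈ S i ∧ v ∉ S i := by
  obtain ⟨hXU, htight, v, hvX, hv, hne⟩ := hX.prop
  obtain ⟨i, hiX, hiv⟩ : ∃ i ∈ colors S X, i ∉ colors S {v} := not_subset.1 fun hsub ↦
    hne (hsub.antisymm (colors_mono (singleton_subset_iff.2 hvX)))
  rw [mem_colors_singleton] at hiv
  let Y := X.filter fun w ↦ w ∈ S i ∨ h ≤ (colors S {w}).card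
  let Z := X.filter fun w ↦ ¬ (w ∈ S i ∨ h ≤ (colors S {w}).card)
  have hYZ : Y ∪ Z = X := filter_union_filter_not_eq _ X
  have hvZ : v ∈ Z := mem_filter.2 ⟨hvX, by simp [hiv, hv]⟩
  obtain ⟨w, hw⟩ := mem_colors.1 hiX
  have hwY : w ∈ Y := mem_filter.2 ⟨(mem_inter.1 hw).2, Or.inl (mem_inter.1 hw).1⟩
  have hdisj : Disjoint Y Z := disjoint_filter_filter_not X X _
  by_contra! hno
  have hsplit : ∀ e ∈ F, A e ⊆ Y ∪ Z → A e ⊆ Y ∨ A e ⊆ Z := by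
    intro e he heX
    by_contra! hcross
    obtain ⟨u₁, hu₁, hu₁Y⟩ := not_subset.1 hcross.1
    obtain ⟨u₂, hu₂, hu₂Z⟩ := not_subset.1 hcross.2
    have hu₁Z := (mem_filter.1 ((mem_union.1 (heX hu₁)).resolve_left hu₁Y)).2
    have hu₂Y := (mem_filter.1 ((mem_union.1 (heX hu₂)).resolve_right hu₂Z)).2
    push Not at hu₁Z
    have hno' := hno e he (hYZ ▸ heX) u₂ hu₂ u₁ hu₁ hu₁Z.2
    refine hu₂Y.elim (fun hi ↦ hu₁Z.1 (hno' i hi)) fun hsat ↦ ?_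
    refine (hu₁Z.2.trans_le hsat).not_ge (card_le_card fun j hj ↦ ?_)
    exact mem_colors_singleton.2 (hno' j (mem_colors_singleton.1 hj))
  obtain ⟨htightZ, hhZ⟩ := hsp.isTight_right_of_union ((filter_subset _ _).trans hXU)
    ((filter_subset _ _).trans hXU) ⟨w, hwY⟩ ⟨v, hvZ⟩ hdisj (hYZ.symm ▸ htight) hsplit
  have hZ : IsCritical U F A S h Z :=
    ⟨(filter_subset _ _).trans hXU, htightZ, v, hvZ, hv, fun heq ↦ by rw [heq] at hhZ; omega⟩
  exact disjoint_left.1 hdisj hwY (hX.le_of_le hZ (filter_subset _ _) (mem_inter.1 hw).2)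

section Exchange

variable [DecidableEq K] {i : K} {v : V}

theorem colors_update_insert_of_mem (hv : v ∈ X) :
    colors (Function.update S i (insert v (S i))) X = insert i (colors S X) := by
  ext j
  rw [mem_insert, mem_colors, mem_colors]
  rcases eq_or_ne j i with rfl | hj
  · rw [Function.update_self]
    exact iff_of_true ⟨v, mem_inter.2 ⟨mem_insert_self _ _, hv⟩⟩ (Or.inl rfl)
  · rw [Function.update_of_ne hj, or_iff_right hj]

theorem colors_update_insert_of_notMem (hv : v ∉ X) :
    colors (Function.update S i (insert v (S i))) X = colors S X := by
  ext j
  rw [mem_colors, mem_colors]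
  rcases eq_or_ne j i with rfl | hj
  · rw [Function.update_self, insert_inter_of_notMem hv]
  · rw [Function.update_of_ne hj]

theorem sum_card_colors_update_insert_of_mem (hv : v ∈ X) (hvi : v ∉ S i) :
    ∑ w ∈ X, (colors (Function.update S i (insert v (S i))) {w}).card =
      ∑ w ∈ X, (colors S {w}).card + 1 := by
  rw [← add_sum_erase _ _ hv, ← add_sum_erase X (fun w ↦ (colors S {w}).card) hv,
    colors_update_insert_of_mem (mem_singleton_self v),
    card_insert_of_notMem (mt mem_colors_singleton.1 hvi), add_right_comm]
  refine congrArg (_ + · + 1) (sum_congr rfl fun w hw ↦ ?_)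
  rw [colors_update_insert_of_notMem (mt mem_singleton.1 (ne_of_mem_erase hw).symm)]

theorem load_erase_update_insert_of_notMem [DecidableEq E] (hv : v ∉ X) (e : E) :
    load (F.erase e) A (Function.update S i (insert v (S i))) h X ≤ load F A S h X := by
  have hsum : ∑ w ∈ X, (colors (Function.update S i (insert v (S i))) {w}).card =
      ∑ w ∈ X, (colors S {w}).card := sum_congr rfl fun w hw ↦ by
    rw [colors_update_insert_of_notMem (notMem_singleton.2 (ne_of_mem_of_not_mem hw hv).symm)]
  rw [load, load, hsum, colors_update_insert_of_notMem hv]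
  gcongr
  exact filter_subset_filter _ (erase_subset e F)

theorem load_erase_update_insert_of_subset [DecidableEq E] {e : E} (he : e ∈ F) (heX : A e ⊆ X)
    (hv : v ∈ X) (hvi : v ∉ S i) :
    load (F.erase e) A (Function.update S i (insert v (S i))) h X ≤ load F A S h X := by
  have hspanned : (spanned (F.erase e) A X).card + 1 = (spanned F A X).card := by
    rw [spanned, filter_erase]
    exact card_erase_add_one (mem_filter.2 ⟨he, heX⟩)
  have hcolors : (colors S X).card ≤ (insert i (colors S X)).card :=
    card_le_card (subset_insert _ _)
  rw [load, load, sum_card_colors_update_insert_of_mem hv hvi, colors_update_insert_of_mem hv]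
  omega

theorem load_erase_update_insert_of_isTight_imp [DecidableEq E] {e : E} (hv : v ∈ X) (hvi : v ∉ S i)
    (hle : load F A S h X ≤ h * X.card)
    (htight : IsTight F A S h X → i ∉ colors S X ∧ (colors S X).card < h) :
    load (F.erase e) A (Function.update S i (insert v (S i))) h X ≤ h * X.card := by
  have hspanned : (spanned (F.erase e) A X).card ≤ (spanned F A X).card :=
    card_le_card (filter_subset_filter _ (erase_subset e F))
  have hcolors : (colors S X).card ≤ (insert i (colors S X)).card :=
    card_le_card (subset_insert _ _)
  rw [load, sum_card_colors_update_insert_of_mem hv hvi, colors_update_insert_of_mem hv]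
  by_cases hX : IsTight F A S h X
  · obtain ⟨hi, hlt⟩ := htight hX
    rw [card_insert_of_notMem hi]
    rw [load] at hle
    omega
  · have := lt_of_le_of_ne hle hX
    rw [load] at this
    omega

theorem IsSparse.exchange [DecidableEq E] (hsp : IsSparse U F A S h)
    (hX : Minimal (IsCritical U F A S h) X) {e : E} (he : e ∈ F) (heX : A e ⊆ X) {u : V}
    (hu : u ∈ A e) (hv : v ∈ A e) (hvh : (colors S {v}).card < h) (hui : u ∈ S i) (hvi : v ∉ S i) :
    IsSparse U (F.erase e) A (Function.update S i (insert v (S i))) h := by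
  refine ⟨fun Z hZU hZ ↦ ?_, ?_⟩
  · have hle := hsp.load_le Z hZU hZ
    by_cases hvZ : v ∉ Z
    · exact (load_erase_update_insert_of_notMem hvZ e).trans hle
    rw [not_not] at hvZ
    by_cases heZ : A e ⊆ Z
    · exact (load_erase_update_insert_of_subset he heZ hvZ hvi).trans hle
    refine load_erase_update_insert_of_isTight_imp hvZ hvi hle fun htight ↦ ?_
    have hXZ : v ∈ X ∩ Z := mem_inter.2 ⟨heX hv, hvZ⟩
    have hnot : ¬ IsCritical U F A S h (X ∩ Z) := fun hcrit ↦
      heZ (heX.trans ((hX.le_of_le hcrit inter_subset_left).trans inter_subset_right))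
    have hcolors : colors S (X ∩ Z) = colors S {v} := by
      by_contra hne
      exact hnot ⟨inter_subset_left.trans hX.prop.subset, (hsp.isTight_inter hX.prop.subset hZU
        hX.prop.isTight htight ⟨v, hXZ⟩).1, v, hXZ, hvh, hne⟩
    have hmem := hsp.mem_colors_inter hX.prop.subset hZU hX.prop.isTight htight ⟨v, hXZ⟩
      (i := i) (mem_colors.2 ⟨u, mem_inter.2 ⟨hui, heX hu⟩⟩)
    rw [hcolors, mem_colors_singleton] at hmem
    by_contra! hcon
    exact hvi (hmem (by tauto) hvh)
  · have heq := hsp.card_add_sum_eq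
    have hcard := card_erase_add_one he
    rw [sum_card_colors_update_insert_of_mem (hX.prop.subset (heX hv)) hvi]
    omega

theorem IsSparse.exists_exchange [DecidableEq E] (hsp : IsSparse U F A S h) (hF : F.Nonempty)
    (hAU : ∀ e ∈ F, A e ⊆ U) :
    ∃ e ∈ F, ∃ u ∈ A e, ∃ v ∈ A e, ∃ i, u ∈ S i ∧ v ∉ S i ∧
      IsSparse U (F.erase e) A (Function.update S i (insert v (S i))) h := by
  obtain ⟨X, -, hX⟩ := exists_minimal_le_of_wellFoundedLT (IsCritical U F A S h) U
    (hsp.isCritical_self hF hAU)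
  obtain ⟨e, he, heX, u, hu, v, hv, hvh, i, hui, hvi⟩ := hsp.exists_mem_of_minimal_isCritical hX
  exact ⟨e, he, u, hu, v, hv, i, hui, hvi, hsp.exchange hX he heX hu hv hvh hui hvi⟩

end Exchange

end Sparse

end HyperforestPacking

namespace MultiDigraph

variable {V E : Type*} {D : MultiDigraph V E} {x y : V} {l : List E}

theorem IsDipath.mem_or_exists_enter (hl : D.IsDipath x l y) {X : Finset V} (hy : y ∈ X) :
    x ∈ X ∨ ∃ a ∈ D.arcs, D.head a ∈ X ∧ D.tail a ∉ X := by
  induction l generalizing x with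
  | nil => exact Or.inl (hl ▸ hy)
  | cons a l ih =>
    obtain ⟨ha, rfl, hl⟩ := hl
    refine (ih hl).elim (fun hhead ↦ ?_) Or.inr
    exact or_iff_not_imp_left.2 fun htail ↦ ⟨a, ha, hhead, htail⟩

theorem IsBranching.eq_nil_of_isDipath {S : Finset V} (hD : D.IsBranching S) (hx : x ∈ S)
    (hy : y ∈ S) (hl : D.IsDipath x l y) : x = y ∧ l = [] :=
  Prod.mk.inj ((hD.2 y (hD.1 hy)).unique (y₁ := (x, l)) (y₂ := (y, [])) ⟨hx, hl⟩ ⟨hy, rfl⟩)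

variable [DecidableEq E] {e : E} {u v : V}

/-- The digraph `D` with a new arc `e` from `u` to `v`; an arc of `D` labelled `e` is redirected. -/
def addArc (D : MultiDigraph V E) (e : E) (hu : u ∈ D.verts) (hv : v ∈ D.verts) :
    MultiDigraph V E where
  verts := D.verts
  arcs := insert e D.arcs
  tail := Function.update D.tail e u
  head := Function.update D.head e v
  tail_mem := (Function.forall_update_iff _ fun a w ↦ a ∈ insert e D.arcs → w ∈ D.verts).2
    ⟨fun _ ↦ hu, fun a hae ha ↦ D.tail_mem a (mem_of_mem_insert_of_ne ha hae)⟩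
  head_mem := (Function.forall_update_iff _ fun a w ↦ a ∈ insert e D.arcs → w ∈ D.verts).2
    ⟨fun _ ↦ hv, fun a hae ha ↦ D.head_mem a (mem_of_mem_insert_of_ne ha hae)⟩

theorem IsDipath.addArc (hl : D.IsDipath x l y) (he : e ∉ D.arcs) (hu : u ∈ D.verts)
    (hv : v ∈ D.verts) : (D.addArc e hu hv).IsDipath x l y := by
  induction l generalizing x with
  | nil => exact hl
  | cons a l ih =>
    obtain ⟨ha, htail, hl⟩ := hl
    have hae : a ≠ e := ne_of_mem_of_not_mem ha he
    have hhead : (D.addArc e hu hv).head a = D.head a := Function.update_of_ne hae _ _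
    exact ⟨mem_insert_of_mem ha, (Function.update_of_ne hae _ _).trans htail, hhead ▸ ih hl⟩

theorem IsDipath.of_addArc {hu : u ∈ D.verts} {hv : v ∈ D.verts}
    (hl : (D.addArc e hu hv).IsDipath x l y) :
    D.IsDipath x l y ∨ ∃ l₁ l₂, l = l₁ ++ e :: l₂ ∧ D.IsDipath x l₁ u ∧
      (D.addArc e hu hv).IsDipath v l₂ y := by
  induction l generalizing x with
  | nil => exact Or.inl hl
  | cons a l ih =>
    obtain ⟨ha, htail, hl⟩ := hl
    rcases eq_or_ne a e with rfl | hae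
    · simp only [MultiDigraph.addArc, Function.update_self] at htail hl
      exact Or.inr ⟨[], l, rfl, htail.symm, hl⟩
    · simp only [MultiDigraph.addArc, Function.update_of_ne hae] at htail hl
      have haD : a ∈ D.arcs := mem_of_mem_insert_of_ne ha hae
      refine (ih hl).imp (fun hl ↦ ⟨haD, htail, hl⟩) ?_
      rintro ⟨l₁, l₂, rfl, hl₁, hl₂⟩
      exact ⟨a :: l₁, l₂, rfl, ⟨haD, htail, hl₁⟩, hl₂⟩

theorem IsBranching.isDipath_of_addArc [DecidableEq V] {S : Finset V} {w : V}
    (hD : D.IsBranching (insert v S)) (huS : u ∈ S) (hvS : v ∉ S) {hu : u ∈ D.verts}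
    {hv : v ∈ D.verts} (hx : x ∈ S) (hl : (D.addArc e hu hv).IsDipath x l w) :
    D.IsDipath x l w ∨ ∃ l', x = u ∧ l = e :: l' ∧ D.IsDipath v l' w := by
  refine hl.of_addArc.imp_right ?_
  rintro ⟨l₁, l₂, rfl, hl₁, hl₂⟩
  obtain ⟨rfl, rfl⟩ := hD.eq_nil_of_isDipath (mem_insert_of_mem hx) (mem_insert_of_mem huS) hl₁
  refine ⟨l₂, rfl, rfl, hl₂.of_addArc.resolve_right ?_⟩
  rintro ⟨l₃, l₄, -, hl₃, -⟩
  exact hvS ((hD.eq_nil_of_isDipath (mem_insert_self v S) (mem_insert_of_mem hx) hl₃).1 ▸ hx)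

-- Prepending `e` to the paths starting at `v` turns the old paths into the new ones.
theorem IsBranching.addArc [DecidableEq V] {S : Finset V} (hD : D.IsBranching (insert v S))
    (huS : u ∈ S) (hvS : v ∉ S) (he : e ∉ D.arcs) (hu : u ∈ D.verts) (hv : v ∈ D.verts) :
    (D.addArc e hu hv).IsBranching S := by
  refine ⟨(subset_insert v S).trans hD.1, fun w hw ↦ ?_⟩
  obtain ⟨⟨s, l⟩, ⟨hs : s ∈ insert v S, hl : D.IsDipath s l w⟩, huniq⟩ := hD.2 w hw
  have hold : ∀ {x m}, x ∈ insert v S → D.IsDipath x m w → x = s ∧ m = l := fun hx hm ↦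
    Prod.mk.inj (huniq (_, _) ⟨hx, hm⟩)
  have hl' := hl.addArc he hu hv
  rcases mem_insert.1 hs with rfl | hsS
  · refine ⟨(u, e :: l), ⟨huS, mem_insert_self _ _, Function.update_self .., ?_⟩, ?_⟩
    · simpa only [MultiDigraph.addArc, Function.update_self] using hl'
    · rintro ⟨x, m⟩ ⟨hx, hm⟩
      rcases hD.isDipath_of_addArc huS hvS hx hm with hm | ⟨m', rfl, rfl, hm'⟩
      · exact absurd ((hold (mem_insert_of_mem hx) hm).1 ▸ hx) hvS
      · rw [(hold hs hm').2]
  · refine ⟨(s, l), ⟨hsS, hl'⟩, ?_⟩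
    rintro ⟨x, m⟩ ⟨hx, hm⟩
    rcases hD.isDipath_of_addArc huS hvS hx hm with hm | ⟨m', rfl, rfl, hm'⟩
    · exact Prod.ext_iff.2 (hold (mem_insert_of_mem hx) hm)
    · exact absurd ((hold (mem_insert_self v S) hm').1 ▸ hsS) hvS

end MultiDigraph

namespace HyperforestPacking

section Branchings

variable {V E : Type*} {F : Finset E} {A : E → Finset V}

/-- `D` is a branching with root set `S` whose arcs are obtained from hyperedges in `F`, with vertex
sets given by `A`, by choosing a tail and a head in each of them. -/
structure IsTrimmedBranching (F : Finset E) (A : E → Finset V) (S : Finset V)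
    (D : MultiDigraph V E) : Prop where
  isBranching : D.IsBranching S
  arcs_subset : D.arcs ⊆ F
  tail_mem : ∀ a ∈ D.arcs, D.tail a ∈ A a
  head_mem : ∀ a ∈ D.arcs, D.head a ∈ A a
  tail_ne_head : ∀ a ∈ D.arcs, D.tail a ≠ D.head a

theorem IsTrimmedBranching.mono {F' : Finset E} {S : Finset V} {D : MultiDigraph V E}
    (hD : IsTrimmedBranching F A S D) (hF : F ⊆ F') : IsTrimmedBranching F' A S D :=
  { hD with arcs_subset := hD.arcs_subset.trans hF }

theorem IsTrimmedBranching.addArc [DecidableEq V] [DecidableEq E] {S : Finset V}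
    {D : MultiDigraph V E} {e : E} {u v : V} (hD : IsTrimmedBranching (F.erase e) A (insert v S) D)
    (he : e ∈ F) (hue : u ∈ A e) (hve : v ∈ A e) (huS : u ∈ S) (hvS : v ∉ S) (hu : u ∈ D.verts)
    (hv : v ∈ D.verts) : IsTrimmedBranching F A S (D.addArc e hu hv) := by
  have heD : e ∉ D.arcs := fun heD ↦ notMem_erase e F (hD.arcs_subset heD)
  have hne : ∀ {a}, a ∈ D.arcs → a ≠ e := fun ha ↦ ne_of_mem_of_not_mem ha heD
  refine ⟨hD.isBranching.addArc huS hvS heD hu hv,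
    insert_subset he (hD.arcs_subset.trans (erase_subset e F)), ?_, ?_, ?_⟩
  all_goals
    simp only [MultiDigraph.addArc, forall_mem_insert, Function.update_self]
    refine ⟨?_, fun a ha ↦ ?_⟩
  · exact hue
  · rw [Function.update_of_ne (hne ha)]
    exact hD.tail_mem a ha
  · exact hve
  · rw [Function.update_of_ne (hne ha)]
    exact hD.head_mem a ha
  · exact ne_of_mem_of_not_mem huS hvS
  · rw [Function.update_of_ne (hne ha), Function.update_of_ne (hne ha)]
    exact hD.tail_ne_head a ha

theorem isTrimmedBranching_edgeless (S : Finset V) (f : E → V) :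
    IsTrimmedBranching F A S ⟨S, ∅, f, f, by simp, by simp⟩ where
  isBranching := by
    refine ⟨subset_rfl, fun u hu ↦ ⟨(u, []), ⟨hu, rfl⟩, ?_⟩⟩
    rintro ⟨x, _ | ⟨a, l⟩⟩ ⟨-, hl⟩
    · exact congrArg (·, []) hl
    · exact absurd hl.1 (notMem_empty a)
  arcs_subset := empty_subset F
  tail_mem := by simp
  head_mem := by simp
  tail_ne_head := by simp

variable [DecidableEq V] {K : Type*} [Fintype K] {U : Finset V} {S : K → Finset V} {h : ℕ}

/-- The `D i` are arc-disjoint branchings with root sets `S i` obtained by trimming hyperedges in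
`F`, and each vertex in `U` belongs to exactly `h` of them. -/
structure IsRegularBranchingPacking (U : Finset V) (F : Finset E) (A : E → Finset V)
    (S : K → Finset V) (h : ℕ) (D : K → MultiDigraph V E) : Prop where
  isTrimmedBranching : ∀ i, IsTrimmedBranching F A (S i) (D i)
  disjoint : Pairwise fun i j ↦ Disjoint (D i).arcs (D j).arcs
  card_eq : ∀ v ∈ U, (univ.filter fun i ↦ v ∈ (D i).verts).card = h

theorem IsSparse.card_colors_singleton_le (hsp : IsSparse U F A S h) {v : V} (hv : v ∈ U) :
    (colors S {v}).card ≤ h := by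
  have hle := hsp.load_le {v} (singleton_subset_iff.2 hv) (singleton_nonempty v)
  rw [load, sum_singleton, card_singleton] at hle
  omega

theorem IsSparse.exists_isRegularBranchingPacking_of_empty (hsp : IsSparse U (∅ : Finset E) A S h)
    (f : E → V) : ∃ D : K → MultiDigraph V E, IsRegularBranchingPacking U ∅ A S h D := by
  refine ⟨_, fun i ↦ isTrimmedBranching_edgeless (S i) f,
    fun i j _ ↦ disjoint_empty_left _, fun v hv ↦ ?_⟩
  have hcard := hsp.card_add_sum_eq
  rw [card_empty, zero_add, mul_comm, ← smul_eq_mul, ← sum_const] at hcard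
  rw [← (sum_eq_sum_iff_of_le fun v hv ↦ hsp.card_colors_singleton_le hv).1 hcard v hv]
  congr 1
  ext i
  rw [mem_colors_singleton, mem_filter_univ]

theorem IsRegularBranchingPacking.exists_addArc [DecidableEq E] [DecidableEq K] {e : E} {u v : V}
    {i : K} {D : K → MultiDigraph V E}
    (hD : IsRegularBranchingPacking U (F.erase e) A (Function.update S i (insert v (S i))) h D)
    (he : e ∈ F) (hue : u ∈ A e) (hve : v ∈ A e) (hui : u ∈ S i) (hvi : v ∉ S i) :
    ∃ D' : K → MultiDigraph V E, IsRegularBranchingPacking U F A S h D' := by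
  have hDi := hD.isTrimmedBranching i
  rw [Function.update_self] at hDi
  have hu : u ∈ (D i).verts := hDi.isBranching.1 (mem_insert_of_mem hui)
  have hv : v ∈ (D i).verts := hDi.isBranching.1 (mem_insert_self v _)
  have hnew : ∀ j ≠ i, Disjoint ((D i).addArc e hu hv).arcs (D j).arcs := fun j hj ↦
    disjoint_insert_left.2 ⟨fun hej ↦
      notMem_erase e F ((hD.isTrimmedBranching j).arcs_subset hej), hD.disjoint hj.symm⟩
  refine ⟨Function.update D i ((D i).addArc e hu hv), ?_, fun j j' hjj' ↦ ?_, fun w hw ↦ ?_⟩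
  · refine (Function.forall_update_iff D fun j B ↦ IsTrimmedBranching F A (S j) B).2
      ⟨hDi.addArc he hue hve hui hvi hu hv, fun j hj ↦ ?_⟩
    have hDj := hD.isTrimmedBranching j
    rw [Function.update_of_ne hj] at hDj
    exact hDj.mono (erase_subset e F)
  · rcases eq_or_ne j i with rfl | hj
    · simpa only [Function.update_self, Function.update_of_ne hjj'.symm] using hnew j' hjj'.symm
    rcases eq_or_ne j' i with rfl | hj'
    · simpa only [Function.update_self, Function.update_of_ne hj] using (hnew j hj).symm
    · simpa only [Function.update_of_ne hj, Function.update_of_ne hj'] using hD.disjoint hjj'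
  · rw [← hD.card_eq w hw]
    congr! 3 with j
    rcases eq_or_ne j i with rfl | hj
    · rw [Function.update_self]
      rfl
    · rw [Function.update_of_ne hj]

theorem IsSparse.exists_isRegularBranchingPacking [Nonempty V] (hsp : IsSparse U F A S h)
    (hAU : ∀ e ∈ F, A e ⊆ U) :
    ∃ D : K → MultiDigraph V E, IsRegularBranchingPacking U F A S h D := by
  classical
  induction F using Finset.strongInduction generalizing S with
  | H F ih =>
    rcases F.eq_empty_or_nonempty with rfl | hF
    · exact hsp.exists_isRegularBranchingPacking_of_empty fun _ ↦ Classical.arbitrary V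
    · obtain ⟨e, he, u, hue, v, hve, i, hui, hvi, hsp'⟩ := hsp.exists_exchange hF hAU
      obtain ⟨D, hD⟩ := ih _ (erase_ssubset he) hsp' fun a ha ↦ hAU a (mem_of_mem_erase ha)
      exact hD.exists_addArc he hue hve hui hvi

end Branchings

end HyperforestPacking

namespace Dypergraph

variable {V E : Type*} [DecidableEq V] {D : Dypergraph V E} {B : MultiDigraph V E} {S X : Finset V}

theorem one_le_inDegree :
    1 ≤ D.inDegree X ↔ ∃ a ∈ D.hyperarcs, D.head a ∈ X ∧ ¬ D.tails a ⊆ X := by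
  simp only [inDegree, Nat.one_le_iff_ne_zero, card_ne_zero, filter_nonempty_iff]

theorem mem_core {v : V} : v ∈ D.core S ↔ v ∈ S ∨ 1 ≤ D.inDegree {v} := by
  rw [core, mem_union, mem_filter, or_comm]
  refine or_congr_right (and_iff_right_of_imp fun hv ↦ ?_)
  obtain ⟨a, ha, hhead, -⟩ := one_le_inDegree.1 hv
  exact mem_singleton.1 hhead ▸ D.head_mem a ha

theorem IsTrimming.inter_nonempty_or_one_le_inDegree (hB : D.IsTrimming B) (hS : B.IsBranching S)
    {v : V} (hv : v ∈ B.verts) (hvX : v ∈ X) : (S ∩ X).Nonempty ∨ 1 ≤ D.inDegree X := by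
  obtain ⟨⟨s, l⟩, ⟨hs, hl⟩, -⟩ := hS.2 v hv
  refine (hl.mem_or_exists_enter hvX).imp (fun hsX ↦ ⟨s, mem_inter.2 ⟨hs, hsX⟩⟩) ?_
  rintro ⟨a, ha, hhead, htail⟩
  rw [hB.1] at ha
  obtain ⟨hheadEq, htailMem⟩ := hB.2 a ha
  exact one_le_inDegree.2 ⟨a, ha, hheadEq ▸ hhead, fun hsub ↦ htail (hsub htailMem)⟩

theorem IsTrimming.core_eq (hB : D.IsTrimming B) (hS : B.IsBranching S) : D.core S = B.verts := by
  ext v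
  rw [mem_core]
  refine ⟨fun hv ↦ hv.elim (hS.1 ·) fun hin ↦ ?_, fun hv ↦ ?_⟩
  · obtain ⟨a, ha, hhead, -⟩ := one_le_inDegree.1 hin
    rw [← mem_singleton.1 hhead, ← (hB.2 a ha).1]
    exact B.head_mem a (hB.1 ▸ ha)
  · refine (hB.inter_nonempty_or_one_le_inDegree hS hv (mem_singleton_self v)).imp_left ?_
    rintro ⟨w, hw⟩
    rw [mem_inter, mem_singleton] at hw
    exact hw.2 ▸ hw.1

theorem IsHyperbranching.inter_nonempty_or_one_le_inDegree (hD : D.IsHyperbranching S) {v : V}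
    (hv : v ∈ D.core S) (hvX : v ∈ X) : (S ∩ X).Nonempty ∨ 1 ≤ D.inDegree X := by
  obtain ⟨-, B, hverts, hB, hS⟩ := hD
  exact hB.inter_nonempty_or_one_le_inDegree hS (hverts ▸ hv) hvX

end Dypergraph

namespace HyperforestPacking

section Sufficiency

variable {V E : Type*} [DecidableEq V] {G : MultiHypergraph V E}

theorem numEntering_eq_splitCount (G : MultiHypergraph V E) (P : Finpartition G.verts) :
    G.numEntering P = splitCount G.edges G.ends P := by
  refine congrArg card (filter_congr fun e he ↦ ⟨?_, fun hsplit ↦ ?_⟩)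
  · rintro ⟨X, hX, ⟨v, hv⟩, hdiff⟩ Y hY hYe
    rw [mem_inter] at hv
    rw [P.eq_of_mem_parts hY hX (hYe hv.1) hv.2] at hYe
    exact sdiff_nonempty.1 hdiff hYe
  · obtain ⟨v, hv⟩ := card_pos.1 (two_pos.trans_le (G.two_le_card_ends e he))
    have hvG := G.ends_subset e he hv
    exact ⟨P.part v, P.part_mem.2 hvG, ⟨v, mem_inter.2 ⟨hv, P.mem_part hvG⟩⟩,
      sdiff_nonempty.2 (hsplit _ (P.part_mem.2 hvG))⟩

theorem covers_of_forall_mul_card_parts_le {ι : Type*} [Fintype ι] [DecidableEq ι] {h : ℕ}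
    {ℓ : ι → ℕ} (hP : ∀ P : Finpartition G.verts,
      h * P.parts.card ≤ (∑ i, min (ℓ i) P.parts.card) + G.numEntering P) :
    Covers G.verts G.edges G.ends (fun _ ↦ h) ℓ univ := by
  intro J _ P
  have hmin : ∑ i, min (ℓ i) P.parts.card ≤ ∑ i ∈ univ \ J, ℓ i + J.card * P.parts.card := by
    rw [← sum_sdiff (subset_univ J)]
    exact add_le_add (sum_le_sum fun i _ ↦ min_le_left _ _)
      (sum_le_card_nsmul J _ _ fun i _ ↦ min_le_right _ _)
  have hle := hP P
  rw [numEntering_eq_splitCount] at hle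
  rw [totalExcess_const]
  zify at hle hmin
  rcases le_total ((h : ℤ) - J.card) 0 with hJ | hJ
  · rw [max_eq_right hJ, mul_zero]
    positivity
  · rw [max_eq_left hJ]
    linarith

theorem exists_isRegularBranchingPacking [Nonempty V] {K : Type*} [Fintype K] {h : ℕ} {ℓ : K → ℕ}
    (hℓ : ∀ i, ℓ i ≤ G.verts.card) (hsum : ∑ i, ℓ i ≤ h * G.verts.card)
    (hP : ∀ P : Finpartition G.verts,
      h * P.parts.card ≤ (∑ i, min (ℓ i) P.parts.card) + G.numEntering P) :
    ∃ (S : K → Finset V) (D : K → MultiDigraph V E), (∀ i, S i ⊆ G.verts ∧ (S i).card = ℓ i) ∧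
      IsRegularBranchingPacking G.verts G.edges G.ends S h D := by
  classical
  obtain ⟨F, hF, hcov, hcard⟩ :=
    (covers_of_forall_mul_card_parts_le hP).exists_subset_card_add_sum_eq (fun i _ ↦ hℓ i) hsum
  obtain ⟨S, hS, hcovS⟩ := hcov.exists_roots (isDemand_const _) fun i _ ↦ hℓ i
  replace hS := fun i ↦ hS i (mem_univ i)
  have hcardS : F.card + ∑ i, (S i).card = h * G.verts.card := by
    rw [← hcard, sum_congr rfl fun i _ ↦ (hS i).2]
  obtain ⟨D, hD⟩ := (hcovS.isSparse (fun i ↦ (hS i).1) hcardS).exists_isRegularBranchingPacking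
    fun e he ↦ G.ends_subset e (hF he)
  exact ⟨S, D, hS, { hD with isTrimmedBranching := fun i ↦ (hD.isTrimmedBranching i).mono hF }⟩

theorem IsTrimmedBranching.exists_isOrientation {S : Finset V} {B : MultiDigraph V E}
    (hB : IsTrimmedBranching G.edges G.ends S B) (hS : S ⊆ G.verts) :
    ∃ (H : MultiHypergraph V E) (D : Dypergraph V E), H.IsSubhypergraph G ∧ H.edges = B.arcs ∧
      H.IsOrientation D ∧ D.IsHyperbranching S ∧ D.core S = B.verts := by
  have hends : ∀ a ∈ B.arcs, G.ends a ⊆ G.verts := fun a ha ↦ G.ends_subset a (hB.arcs_subset ha)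
  have htail : ∀ a ∈ B.arcs, B.tail a ∈ (G.ends a).erase (B.head a) := fun a ha ↦
    mem_erase.2 ⟨hB.tail_ne_head a ha, hB.tail_mem a ha⟩
  let H : MultiHypergraph V E :=
    { verts := G.verts
      edges := B.arcs
      ends := G.ends
      ends_subset := hends
      two_le_card_ends := fun a ha ↦ G.two_le_card_ends a (hB.arcs_subset ha) }
  let D : Dypergraph V E :=
    { verts := G.verts
      hyperarcs := B.arcs
      tails := fun a ↦ (G.ends a).erase (B.head a)
      head := B.head
      tails_subset := fun a ha ↦ (erase_subset _ _).trans (hends a ha)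
      head_mem := fun a ha ↦ hends a ha (hB.head_mem a ha)
      tails_nonempty := fun a ha ↦ ⟨B.tail a, htail a ha⟩
      head_notMem_tails := fun a _ ↦ notMem_erase _ _ }
  have htrim : D.IsTrimming B := ⟨rfl, fun a ha ↦ ⟨rfl, htail a ha⟩⟩
  have hcore : D.core S = B.verts := htrim.core_eq hB.isBranching
  exact ⟨H, D, ⟨subset_rfl, hB.arcs_subset, fun _ _ ↦ rfl⟩, rfl,
    ⟨rfl, rfl, fun a ha ↦ ⟨hB.head_mem a ha, rfl⟩⟩,
    ⟨hS, B, hcore.symm, htrim, hB.isBranching⟩, hcore⟩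

theorem IsRegularBranchingPacking.exists_isRegularPacking {h k : ℕ} {S : Fin k → Finset V}
    {B : Fin k → MultiDigraph V E} (hB : IsRegularBranchingPacking G.verts G.edges G.ends S h B)
    (hS : ∀ i, S i ⊆ G.verts) : ∃ H : Fin k → MultiHypergraph V E, G.IsRegularPacking h H S := by
  choose H D hH hedges horient hbranch hcore using fun i ↦
    (hB.isTrimmedBranching i).exists_isOrientation (hS i)
  refine ⟨H, ⟨fun i ↦ ⟨hH i, D i, horient i, hbranch i⟩, ?_⟩,
    D, fun i ↦ ⟨horient i, hbranch i⟩, ?_⟩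
  · simpa only [hedges] using hB.disjoint
  · simpa only [hcore] using hB.card_eq

end Sufficiency

section Necessity

variable {V E : Type*} [DecidableEq V] {G : MultiHypergraph V E} {h k : ℕ}
  {H : Fin k → MultiHypergraph V E} {S : Fin k → Finset V}

theorem roots_subset_of_isRegularPacking (hH : G.IsRegularPacking h H S) (i : Fin k) :
    S i ⊆ G.verts := by
  obtain ⟨⟨hsub, -⟩, D, hD, -⟩ := hH
  exact (hD i).2.1.trans ((hD i).1.1.subset.trans (hsub i).1.1)

theorem sum_card_roots_le_of_isRegularPacking (hH : G.IsRegularPacking h H S) :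
    ∑ i, (S i).card ≤ h * G.verts.card := by
  rw [← sum_card_colors_singleton (roots_subset_of_isRegularPacking hH), mul_comm]
  obtain ⟨-, D, -, hcard⟩ := hH
  refine sum_le_card_nsmul _ _ _ fun v hv ↦ (card_le_card fun i hi ↦ ?_).trans_eq (hcard v hv)
  exact (mem_filter_univ i).2 (Dypergraph.mem_core.2 (Or.inl (mem_colors_singleton.1 hi)))

theorem sum_card_colors_parts_le {K : Type*} [Fintype K] {U : Finset V} (P : Finpartition U)
    (S : K → Finset V) :
    ∑ X ∈ P.parts, (colors S X).card ≤ ∑ i, min (S i).card P.parts.card := by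
  simp only [colors, card_filter]
  rw [sum_comm]
  refine sum_le_sum fun i _ ↦ ?_
  rw [← card_filter]
  refine le_min ((card_le_card fun X hX ↦ ?_).trans (card_image_le (f := P.part)))
    (card_filter_le _ _)
  obtain ⟨hX, v, hv⟩ := mem_filter.1 hX
  rw [mem_inter] at hv
  exact mem_image.2 ⟨v, hv.1, P.part_eq_of_mem hX hv.2⟩

theorem card_filter_mem_core_le {K : Type*} [Fintype K] {S : K → Finset V}
    {D : K → Dypergraph V E} (hD : ∀ i, (D i).IsHyperbranching (S i)) {v : V} {X : Finset V}
    (hv : v ∈ X) :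
    (univ.filter fun i ↦ v ∈ (D i).core (S i)).card ≤
      (colors S X).card + ∑ i, (D i).inDegree X := by
  rw [colors, card_filter, card_filter, ← sum_add_distrib]
  refine sum_le_sum fun i _ ↦ ?_
  by_cases hi : v ∈ (D i).core (S i)
  · rcases (hD i).inter_nonempty_or_one_le_inDegree hi hv with hS | hin
    · rw [if_pos hi, if_pos hS]
      exact Nat.le_add_right _ _
    · rw [if_pos hi]
      exact hin.trans (Nat.le_add_left _ _)
  · rw [if_neg hi]
    exact Nat.zero_le _

theorem sum_inDegree_parts_le_splitCount {H : MultiHypergraph V E} {D : Dypergraph V E}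
    {U : Finset V} (P : Finpartition U) (hD : H.IsOrientation D) :
    ∑ X ∈ P.parts, D.inDegree X ≤ splitCount H.edges H.ends P := by
  classical
  obtain ⟨-, harcs, hends⟩ := hD
  unfold Dypergraph.inDegree
  rw [← card_biUnion fun X hX Y hY hXY ↦ disjoint_filter.2 fun a _ ha ha' ↦
    disjoint_left.1 (P.disjoint hX hY hXY) ha.1 ha'.1, harcs]
  refine card_le_card (biUnion_subset.2 fun X hX ↦ monotone_filter_right _ ?_)
  rintro e he ⟨hhead, htails⟩ Y hY heY
  obtain ⟨hmem, htailsEq⟩ := hends e he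
  rw [P.eq_of_mem_parts hX hY hhead (heY hmem), htailsEq] at htails
  exact htails ((erase_subset _ _).trans heY)

theorem sum_splitCount_le_of_isPacking {U : Finset V} (P : Finpartition U)
    (hH : G.IsPacking H S) :
    ∑ i, splitCount (H i).edges (H i).ends P ≤ splitCount G.edges G.ends P := by
  classical
  obtain ⟨hsub, hdisj⟩ := hH
  unfold splitCount
  rw [← card_biUnion fun i _ j _ hij ↦ disjoint_filter_filter (hdisj hij)]
  refine card_le_card (biUnion_subset.2 fun i _ e he ↦ ?_)
  obtain ⟨-, hedges, hends⟩ := (hsub i).1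
  obtain ⟨he, hsplit⟩ := mem_filter.1 he
  exact mem_filter.2 ⟨hedges he, hends e he ▸ hsplit⟩

theorem mul_card_parts_le_of_isRegularPacking (hH : G.IsRegularPacking h H S)
    (P : Finpartition G.verts) :
    h * P.parts.card ≤ (∑ i, min (S i).card P.parts.card) + G.numEntering P := by
  obtain ⟨hpack, D, hD, hcard⟩ := hH
  have hpart : ∀ X ∈ P.parts, h ≤ (colors S X).card + ∑ i, (D i).inDegree X := fun X hX ↦ by
    obtain ⟨v, hv⟩ := P.nonempty_of_mem_parts hX
    exact (hcard v (P.le hX hv)).ge.trans (card_filter_mem_core_le (fun i ↦ (hD i).2) hv)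
  calc h * P.parts.card
      ≤ ∑ X ∈ P.parts, ((colors S X).card + ∑ i, (D i).inDegree X) := by
        rw [mul_comm]
        exact card_nsmul_le_sum _ _ _ hpart
    _ = ∑ X ∈ P.parts, (colors S X).card + ∑ i, ∑ X ∈ P.parts, (D i).inDegree X := by
        rw [sum_add_distrib, sum_comm (s := P.parts)]
    _ ≤ ∑ i, min (S i).card P.parts.card + ∑ i, splitCount (H i).edges (H i).ends P :=
        add_le_add (sum_card_colors_parts_le P S)
          (sum_le_sum fun i _ ↦ sum_inDegree_parts_le_splitCount P (hD i).1)
    _ ≤ ∑ i, min (S i).card P.parts.card + G.numEntering P := by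
        rw [numEntering_eq_splitCount]
        exact Nat.add_le_add_left (sum_splitCount_le_of_isPacking P hpack) _

end Necessity

end HyperforestPacking

open HyperforestPacking

theorem mainTheorem7 {V E : Type*} [DecidableEq V] (G : MultiHypergraph V E)
    (h k : ℕ) (hh : 0 < h) (hk : 0 < k) (ℓ : Fin k → ℕ) (hℓ : ∀ i, 0 < ℓ i) :
    (∃ (H : Fin k → MultiHypergraph V E) (S : Fin k → Finset V),
        G.IsRegularPacking h H S ∧ ∀ i, (S i).card = ℓ i) ↔
      (∀ i, ℓ i ≤ G.verts.card) ∧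
      ∑ i, ℓ i ≤ h * G.verts.card ∧
      ∀ P : Finpartition G.verts,
        h * P.parts.card ≤ (∑ i, min (ℓ i) P.parts.card) + G.numEntering P := by
  constructor
  · rintro ⟨H, S, hH, hS⟩
    obtain rfl : (fun i ↦ (S i).card) = ℓ := funext hS
    exact ⟨fun i ↦ card_le_card (roots_subset_of_isRegularPacking hH i),
      sum_card_roots_le_of_isRegularPacking hH, mul_card_parts_le_of_isRegularPacking hH⟩
  · rintro ⟨hcard, hsum, hP⟩
    obtain ⟨v, -⟩ := card_pos.1 ((hℓ ⟨0, hk⟩).trans_le (hcard ⟨0, hk⟩))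
    have : Nonempty V := ⟨v⟩
    obtain ⟨S, B, hS, hB⟩ := exists_isRegularBranchingPacking hcard hsum hP
    obtain ⟨H, hH⟩ := hB.exists_isRegularPacking fun i ↦ (hS i).1
    exact ⟨H, S, hH, fun i ↦ (hS i).2⟩
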